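/- Let $\Bbbk$ be a field, $d\ge 1$, $S=\Bbbk[x,y]$, and let $B=\bigoplus_{n\ge 0}S_{nd}$ be the homogeneous coordinate ring of the rational normal curve of degree $d$, graded by $B_n=S_{nd}$, with homogeneous maximal ideal $\mathfrak m$. For $0\le \ell\le d-1$ let $M^{(\ell)}=\bigoplus_{n\ge 0}S_{nd+\ell}$, a graded $B$-module with $M^{(\ell)}_n=S_{nd+\ell}$. For a graded $B$-module $N$ write $N(-a)_j=N_{j-a}$. A finite-length graded $B$-module $M$ has a pure resolution of type $(d_0,d_1,d_2;\ell)$, where $d_0,d_1,d_2\in\mathbb Z$, if there are integers $a,b,r\ge 0$ and an exact sequence of graded $B$-modules with degree-preserving maps $$0\to M^{(\ell)}(-d_2)^{r}\to B(-d_1)^{b}\to B(-d_0)^{a}\to M\to 0$$ which is minimal, i.e. the image of $M^{(\ell)}(-d_2)^{r}$ lies in $\mathfrak m B(-d_1)^{b}$ and the image of $B(-d_1)^{b}$ lies in $\mathfrak m B(-d_0)^{a}$. Put $\beta_{i,j}=\dim_\Bbbk \operatorname{Tor}_i^B(\Bbbk,M)_j$ and $\beta_i=\sum_j\beta_{i,j}$.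 Suppose that a finite-length graded $B$-module $M$ has a pure resolution of type $(d_0,d_1,d_2;\ell)$ with $0\le\ell\le d-1$. Then all $\beta_{i,j}$ are finite; $\beta_{0,j}=0$ for $j\ne d_0$; $\beta_{1,j}=0$ for $j\neq d_1$; and for every $i\ge 2$, $\beta_{i,j}=0$ for $j\ne d_2+i-2$. The Betti numbers of $M$ are determined up to a scalar multiple: there is a rational number $c$, positive if $M\ne 0$, such that $$(\beta_0,\beta_1,\beta_2)=c\cdot\bigl(d(d_2-d_1)-\ell,\; d(d_2-d_0)-\ell,\; d(d_1-d_0)(\ell+1)\bigr),$$ and $$\beta_i=(d-1)^{i-3}\,\beta_2\,\frac{d\ell}{\ell+1}\qquad\text{for all } i\ge 3$$ (with $0^0=1$). -/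

import Mathlib

universe u v w

noncomputable section

namespace RatNormal

/-! ### The rings `S = k[x, y]` and `B`, and the modules `M^(ℓ)` -/

/-- The forms of degree `e` in `S = k[x, y]`, for an integer `e` (only `0` if `e < 0`). -/
def forms (k : Type u) [Field k] (e : ℤ) : Submodule k (MvPolynomial (Fin 2) k) where
  carrier := {p | ∀ m ∈ p.support, (m.degree : ℤ) = e}
  zero_mem' := by simp
  add_mem' := by
    intro a b ha hb m hm
    rcases Finset.mem_union.1 (MvPolynomial.support_add hm) with h | h
    · exact ha m h
    · exact hb m h
  smul_mem' := by
    intro c a ha m hm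
    exact ha m (MvPolynomial.support_smul hm)

theorem mul_mem_forms {k : Type u} [Field k] {e e' : ℤ} {p q : MvPolynomial (Fin 2) k}
    (hp : p ∈ forms k e) (hq : q ∈ forms k e') : p * q ∈ forms k (e + e') := by
  classical
  intro m hm
  obtain ⟨a, ha, b, hb, rfl⟩ := Finset.mem_add.1 (MvPolynomial.support_mul p q hm)
  have h1 := hp a ha
  have h2 := hq b hb
  rw [map_add, Nat.cast_add, h1, h2]

/-- The homogeneous coordinate ring `B = ⨁ₙ S_{nd}` of the rational normal curve of degree `d`,
as a subalgebra of `S = k[x, y]`. -/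
def coordSubalgebra (k : Type u) [Field k] (d : ℕ) : Subalgebra k (MvPolynomial (Fin 2) k) where
  carrier := {p | ∀ m ∈ p.support, ∃ n : ℕ, m.degree = n * d}
  add_mem' := by
    intro a b ha hb m hm
    rcases Finset.mem_union.1 (MvPolynomial.support_add hm) with h | h
    · exact ha m h
    · exact hb m h
  mul_mem' := by
    classical
    intro p q hp hq m hm
    obtain ⟨a, ha, b, hb, rfl⟩ := Finset.mem_add.1 (MvPolynomial.support_mul p q hm)
    obtain ⟨n, hn⟩ := hp a ha
    obtain ⟨n', hn'⟩ := hq b hb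
    exact ⟨n + n', by rw [map_add, hn, hn', add_mul]⟩
  algebraMap_mem' := by
    classical
    intro r m hm
    rw [MvPolynomial.algebraMap_eq, MvPolynomial.mem_support_iff, MvPolynomial.coeff_C] at hm
    refine ⟨0, ?_⟩
    by_cases h : (0 : Fin 2 →₀ ℕ) = m
    · simp [← h]
    · simp [h] at hm

/-- The ring `B`, as a type. -/
def CoordRing (k : Type u) [Field k] (d : ℕ) : Type u := coordSubalgebra k d

instance (k : Type u) [Field k] (d : ℕ) : CommRing (CoordRing k d) :=
  inferInstanceAs (CommRing (coordSubalgebra k d))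

instance (k : Type u) [Field k] (d : ℕ) : Algebra k (CoordRing k d) :=
  inferInstanceAs (Algebra k (coordSubalgebra k d))

/-- The inclusion `B ⊆ S`. -/
def incl (k : Type u) [Field k] (d : ℕ) : CoordRing k d →ₐ[k] MvPolynomial (Fin 2) k :=
  (coordSubalgebra k d).val

instance (k : Type u) [Field k] (d : ℕ) : Algebra (CoordRing k d) (MvPolynomial (Fin 2) k) :=
  (incl k d).toRingHom.toAlgebra

instance (k : Type u) [Field k] (d : ℕ) :
    IsScalarTower k (CoordRing k d) (MvPolynomial (Fin 2) k) :=
  IsScalarTower.of_algebraMap_eq fun r => ((incl k d).commutes r).symm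

/-- The degree `n` part `B_n = S_{nd}` of `B`, for an integer `n` (only `0` if `n < 0`). -/
def ringPiece (k : Type u) [Field k] (d : ℕ) (n : ℤ) : Submodule k (CoordRing k d) :=
  (forms k (d * n)).comap (incl k d).toLinearMap

/-- The homogeneous maximal ideal `𝔪` of `B`: the elements with zero constant term. -/
def irrelevant (k : Type u) [Field k] (d : ℕ) : Ideal (CoordRing k d) :=
  RingHom.ker ((MvPolynomial.constantCoeff (R := k) (σ := Fin 2)).comp
    (incl k d).toRingHom)

/-- The underlying `B`-submodule of `S` of the module `M^(ℓ) = ⨁_{n ≥ 0} S_{nd+ℓ}`. -/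
def mcmSubmodule (k : Type u) [Field k] (d ℓ : ℕ) :
    Submodule (CoordRing k d) (MvPolynomial (Fin 2) k) where
  carrier := {p | ∀ m ∈ p.support, ∃ n : ℕ, m.degree = n * d + ℓ}
  zero_mem' := by simp
  add_mem' := by
    intro a b ha hb m hm
    rcases Finset.mem_union.1 (MvPolynomial.support_add hm) with h | h
    · exact ha m h
    · exact hb m h
  smul_mem' := by
    classical
    intro p q hq m hm
    obtain ⟨a, ha, b, hb, rfl⟩ :=
      Finset.mem_add.1 (MvPolynomial.support_mul (incl k d p) q hm)
    obtain ⟨n, hn⟩ := p.2 a ha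
    obtain ⟨n', hn'⟩ := hq b hb
    exact ⟨n + n', by rw [map_add, hn, hn']; ring⟩

/-! ### Graded modules -/

/-- A `ℤ`-graded `B`-module: a `B`-module with an (internal) direct sum decomposition into
`k`-subspaces `piece j`, `j ∈ ℤ`, such that `B_n · M_j ⊆ M_{n+j}`. -/
structure GrMod (k : Type u) [Field k] (d : ℕ) where
  carrier : Type v
  [addCommGroup : AddCommGroup carrier]
  [moduleBase : Module k carrier]
  [module : Module (CoordRing k d) carrier]
  [isScalarTower : IsScalarTower k (CoordRing k d) carrier]
  piece : ℤ → Submodule k carrier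
  isInternal : DirectSum.IsInternal piece
  smul_mem : ∀ (n j : ℤ) (b : CoordRing k d) (m : carrier),
    b ∈ ringPiece k d n → m ∈ piece j → b • m ∈ piece (n + j)

attribute [instance] GrMod.addCommGroup GrMod.moduleBase GrMod.module
  GrMod.isScalarTower

/-- A criterion for an internal direct sum decomposition: the pieces span, and they are separated
by additive maps `φ a` each of which vanishes on all pieces but one. -/
theorem isInternal_of_separating {k : Type u} [Field k] {V : Type v} [AddCommGroup V] [Module k V]
    (p : ℤ → Submodule k V) {A : Type*} {W : A → Type*} [∀ a, AddCommGroup (W a)]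
    (φ : ∀ a, V →+ W a) (hφ : ∀ v, (∀ a, φ a v = 0) → v = 0) (idx : A → ℤ)
    (hidx : ∀ a i, i ≠ idx a → ∀ v ∈ p i, φ a v = 0) (htop : ⨆ i, p i = ⊤) :
    DirectSum.IsInternal p := by
  classical
  refine DirectSum.isInternal_submodule_of_iSupIndep_of_iSup_eq_top ?_ htop
  rw [iSupIndep_def]
  intro i
  rw [Submodule.disjoint_def]
  intro x hx hx'
  refine hφ x fun a => ?_
  by_cases h : i = idx a
  · have : ∀ y ∈ ⨆ j, ⨆ (_ : j ≠ i), p j, φ a y = 0 := by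
      intro y hy
      refine Submodule.iSup_induction _ (motive := fun y => φ a y = 0) hy ?_ (map_zero _) ?_
      · intro j z hz
        by_cases hj : j = i
        · simp [hj] at hz
          rw [hz, map_zero]
        · simp only [ne_eq, hj, not_false_eq_true, iSup_pos] at hz
          exact hidx a j (fun h' => hj (h'.trans h.symm)) z hz
      · intro y z hy hz
        rw [map_add, hy, hz, add_zero]
    exact this x hx'
  · exact hidx a i h x hx

/-- Decompositions by degree of subspaces `V` of `S` spanned by monomials of degrees `nd + ℓ`. -/
theorem isInternal_forms {k : Type u} [Field k] (d : ℕ) [NeZero d] (ℓ : ℕ) {V : Type v}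
    [AddCommGroup V] [Module k V] (i : V →ₗ[k] MvPolynomial (Fin 2) k)
    (hi : Function.Injective i)
    (hV : ∀ p, p ∈ LinearMap.range i ↔ ∀ m ∈ p.support, ∃ n : ℕ, m.degree = n * d + ℓ) :
    DirectSum.IsInternal fun n : ℤ => (forms k (d * n + ℓ)).comap i := by
  classical
  have hd : (d : ℤ) ≠ 0 := by exact_mod_cast NeZero.ne d
  refine isInternal_of_separating _ (A := Fin 2 →₀ ℕ) (W := fun _ => k)
    (fun m => ((MvPolynomial.lcoeff k m).comp i).toAddMonoidHom) ?_
    (fun m => ((m.degree : ℤ) - ℓ) / d) ?_ ?_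
  · intro v hv
    apply hi
    rw [map_zero]
    ext m
    simpa using hv m
  · intro m j hj v hv
    by_contra hne
    apply hj
    have h1 : (m.degree : ℤ) = d * j + ℓ := hv m (MvPolynomial.mem_support_iff.2 hne)
    rw [h1, add_sub_cancel_right, Int.mul_ediv_cancel_left _ hd]
  · rw [eq_top_iff]
    intro v _
    have hmon : ∀ m ∈ (i v).support, ∃ w : V,
        i w = MvPolynomial.monomial m ((i v).coeff m) ∧
          w ∈ ⨆ n : ℤ, (forms k (d * n + ℓ)).comap i := by
      intro m hm
      obtain ⟨n, hn⟩ := (hV (i v)).1 ⟨v, rfl⟩ m hm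
      have hs : ∀ m' ∈ (MvPolynomial.monomial m ((i v).coeff m)).support, m' = m := by
        intro m' hm'
        simpa using MvPolynomial.support_monomial_subset hm'
      obtain ⟨w, hw⟩ := (hV (MvPolynomial.monomial m ((i v).coeff m))).2
        (fun m' hm' => ⟨n, by rw [hs m' hm', hn]⟩)
      refine ⟨w, hw, Submodule.mem_iSup_of_mem (n : ℤ) ?_⟩
      rw [Submodule.mem_comap, hw]
      intro m' hm'
      rw [hs m' hm', hn]
      push_cast
      ring
    choose! f hf using hmon
    have : v = ∑ m ∈ (i v).support, f m := by
      apply hi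
      rw [map_sum, Finset.sum_congr rfl fun m hm => (hf m hm).1,
        MvPolynomial.support_sum_monomial_coeff]
    rw [this]
    exact Submodule.sum_mem _ fun m hm => (hf m hm).2

/-- The ring `B` as a graded module over itself. -/
def ringGr (k : Type u) [Field k] (d : ℕ) [NeZero d] : GrMod.{u, u} k d where
  carrier := CoordRing k d
  piece := ringPiece k d
  isInternal := by
    have h := isInternal_forms (k := k) d 0 (incl k d).toLinearMap
      Subtype.val_injective (by
        intro p
        constructor
        · rintro ⟨q, rfl⟩ m hm
          exact q.2 m hm
        · intro h
          exact ⟨⟨p, h⟩, rfl⟩)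
    have e : (fun n : ℤ => (forms k (d * n + (0 : ℕ))).comap (incl k d).toLinearMap)
        = ringPiece k d := by
      funext n
      simp [ringPiece]
    rwa [e] at h
  smul_mem := by
    intro n j b m hb hm
    have := mul_mem_forms hb hm
    rwa [← mul_add] at this

/-- The graded module `M^(ℓ)`, whose degree `n` part is `S_{nd+ℓ}`. -/
def mcmGr (k : Type u) [Field k] (d : ℕ) [NeZero d] (ℓ : ℕ) : GrMod.{u, u} k d where
  carrier := mcmSubmodule k d ℓ
  piece n := (forms k (d * n + ℓ)).comap ((mcmSubmodule k d ℓ).subtype.restrictScalars k)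
  isInternal := by
    refine isInternal_forms (k := k) d ℓ _ Subtype.val_injective (by
        intro p
        constructor
        · rintro ⟨q, rfl⟩ m hm
          exact q.2 m hm
        · intro h
          exact ⟨⟨p, h⟩, rfl⟩)
  smul_mem := by
    intro n j b m hb hm
    have := mul_mem_forms hb hm
    rwa [← add_assoc, ← mul_add] at this

namespace GrMod

variable {k : Type u} [Field k] {d : ℕ}

/-- The projection of a graded module to its degree `j` part. -/
def proj (M : GrMod.{u, v} k d) (j : ℤ) : M.carrier →ₗ[k] M.carrier :=
  letI := M.isInternal.chooseDecomposition
  (M.piece j).subtype ∘ₗ DirectSum.component k ℤ (fun i => M.piece i) j ∘ₗ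
    (DirectSum.decomposeLinearEquiv M.piece).toLinearMap

theorem proj_mem (M : GrMod.{u, v} k d) (j : ℤ) (m : M.carrier) :
    M.proj j m ∈ M.piece j := by
  simp [proj]

theorem proj_of_mem (M : GrMod.{u, v} k d) {j : ℤ} {m : M.carrier} (h : m ∈ M.piece j) :
    M.proj j m = m := by
  let _ := M.isInternal.chooseDecomposition
  exact DirectSum.decompose_of_mem_same M.piece h

theorem proj_of_mem_ne (M : GrMod.{u, v} k d) {i j : ℤ} {m : M.carrier}
    (h : m ∈ M.piece i) (hij : i ≠ j) : M.proj j m = 0 := by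
  let _ := M.isInternal.chooseDecomposition
  exact DirectSum.decompose_of_mem_ne M.piece h hij

theorem exists_sum_proj (M : GrMod.{u, v} k d) (m : M.carrier) :
    ∃ s : Finset ℤ, m = ∑ j ∈ s, M.proj j m := by
  classical
  let _ := M.isInternal.chooseDecomposition
  exact ⟨_, (DirectSum.sum_support_decompose M.piece m).symm⟩

theorem eq_zero_of_proj (M : GrMod.{u, v} k d) (m : M.carrier)
    (h : ∀ j, M.proj j m = 0) : m = 0 := by
  obtain ⟨s, hs⟩ := M.exists_sum_proj m
  rw [hs]
  exact Finset.sum_eq_zero fun j _ => h j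

/-- The graded direct sum `⨁_{x ∈ ι} N(-e x)` of shifted copies of `N`, where `N(-a)_j = N_{j-a}`:
finitely supported functions on `ι`. -/
def copies (N : GrMod.{u, v} k d) {ι : Type w} (e : ι → ℤ) :
    GrMod.{u, max w v} k d where
  carrier := ι →₀ N.carrier
  piece j :=
    { carrier := {f | ∀ x, f x ∈ N.piece (j - e x)}
      zero_mem' := fun x => Submodule.zero_mem _
      add_mem' := fun ha hb x => Submodule.add_mem _ (ha x) (hb x)
      smul_mem' := fun c _ ha x => Submodule.smul_mem _ c (ha x) }
  isInternal := by
    classical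
    refine isInternal_of_separating _ (A := ι × ℤ) (W := fun _ => N.carrier)
      (fun a => ((N.proj a.2).comp (Finsupp.lapply a.1)).toAddMonoidHom) ?_
      (fun a => a.2 + e a.1) ?_ ?_
    · intro f hf
      ext x
      exact N.eq_zero_of_proj _ fun j => hf (x, j)
    · rintro ⟨x, n⟩ i hi f hf
      refine N.proj_of_mem_ne (hf x) ?_
      intro h
      apply hi
      change i = n + e x
      change i - e x = n at h
      omega
    · rw [eq_top_iff]
      intro f _
      induction f using Finsupp.induction_linear with
      | zero => exact Submodule.zero_mem _
      | add f g hf hg => exact Submodule.add_mem _ (hf trivial) (hg trivial)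
      | single x n =>
        obtain ⟨s, hs⟩ := N.exists_sum_proj n
        rw [hs, Finsupp.single_finsetSum]
        refine Submodule.sum_mem _ fun j _ => Submodule.mem_iSup_of_mem (j + e x) ?_
        intro y
        by_cases h : x = y
        · subst h
          simpa using N.proj_mem j n
        · rw [Finsupp.single_eq_of_ne' h]
          exact Submodule.zero_mem _
  smul_mem := by
    intro n j b f hb hf x
    have := N.smul_mem n (j - e x) b (f x) hb (hf x)
    rwa [← add_sub_assoc] at this

/-- A `B`-linear map of graded modules that preserves degrees. -/
def IsGradedHom {M : GrMod.{u, v} k d} {N : GrMod.{u, w} k d}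
    (f : M.carrier →ₗ[CoordRing k d] N.carrier) : Prop :=
  ∀ j, ∀ m ∈ M.piece j, f m ∈ N.piece j

theorem proj_apply_of_isGradedHom {M : GrMod.{u, v} k d} {N : GrMod.{u, w} k d}
    {f : M.carrier →ₗ[CoordRing k d] N.carrier} (hf : IsGradedHom f) (j : ℤ) (m : M.carrier) :
    N.proj j (f m) = f (M.proj j m) := by
  classical
  obtain ⟨s, hs⟩ := M.exists_sum_proj m
  rw [hs]
  simp only [map_sum]
  refine Finset.sum_congr rfl fun i _ => ?_
  by_cases h : i = j
  · subst h
    rw [N.proj_of_mem (hf _ _ (M.proj_mem _ _)), M.proj_of_mem (M.proj_mem _ _)]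
  · rw [N.proj_of_mem_ne (hf _ _ (M.proj_mem _ _)) h, M.proj_of_mem_ne (M.proj_mem _ _) h,
      map_zero]

/-- The kernel of a graded homomorphism, as a graded module. -/
def ker {M : GrMod.{u, v} k d} {N : GrMod.{u, w} k d}
    (f : M.carrier →ₗ[CoordRing k d] N.carrier) (hf : IsGradedHom f) :
    GrMod.{u, v} k d where
  carrier := LinearMap.ker f
  piece j := (M.piece j).comap ((LinearMap.ker f).subtype.restrictScalars k)
  isInternal := by
    classical
    refine isInternal_of_separating _ (A := ℤ) (W := fun _ => M.carrier)
      (fun a => ((M.proj a).comp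
        ((LinearMap.ker f).subtype.restrictScalars k)).toAddMonoidHom) ?_ id ?_ ?_
    · intro x hx
      exact Subtype.ext (M.eq_zero_of_proj _ hx)
    · intro a i hi x hx
      exact M.proj_of_mem_ne hx hi
    · rw [eq_top_iff]
      intro x _
      obtain ⟨s, hs⟩ := M.exists_sum_proj (x : M.carrier)
      have hmem : ∀ j, M.proj j (x : M.carrier) ∈ LinearMap.ker f := by
        intro j
        rw [LinearMap.mem_ker, ← proj_apply_of_isGradedHom hf, LinearMap.mem_ker.1 x.2, map_zero]
      have : x = ∑ j ∈ s, (⟨M.proj j (x : M.carrier), hmem j⟩ : LinearMap.ker f) := by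
        apply Subtype.ext
        rw [AddSubmonoidClass.coe_finsetSum]
        exact hs
      rw [this]
      exact Submodule.sum_mem _ fun j _ => Submodule.mem_iSup_of_mem j (M.proj_mem j _)
  smul_mem := by
    intro n j b m hb hm
    exact M.smul_mem n j b m hb hm

end GrMod

/-! ### Graded free resolutions, graded `Tor` and Betti numbers -/

variable {k : Type u} [Field k] {d : ℕ} [NeZero d]

/-- The graded free module `⨁_{x ∈ ι} B(-e x)`; its carrier is `ι →₀ B`. -/
abbrev freeGr (k : Type u) [Field k] (d : ℕ) [NeZero d] {ι : Type w} (e : ι → ℤ) :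
    GrMod.{u, max w u} k d :=
  (ringGr k d).copies e

/-- A graded free resolution `⋯ → F_2 → F_1 → F_0 → M → 0` of a graded `B`-module `M`, where
`F_i = ⨁_x B(-deg i x)`. (It need not be minimal.) -/
structure GradedFreeResolution (M : GrMod.{u, v} k d) where
  ι : ℕ → Type (max u v)
  deg : ∀ i, ι i → ℤ
  diff : ∀ i, (freeGr k d (deg (i + 1))).carrier →ₗ[CoordRing k d] (freeGr k d (deg i)).carrier
  aug : (freeGr k d (deg 0)).carrier →ₗ[CoordRing k d] M.carrier
  diff_graded : ∀ i, GrMod.IsGradedHom (diff i)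
  aug_graded : GrMod.IsGradedHom aug
  aug_surjective : Function.Surjective aug
  exact_zero : Function.Exact (diff 0) aug
  exact_succ : ∀ i, Function.Exact (diff (i + 1)) (diff i)

namespace GrMod

/-- The generators of the standard free cover: all homogeneous elements. -/
abbrev CoverIndex (M : GrMod.{u, v} k d) : Type (max u v) :=
  ULift.{u} (Σ j : ℤ, M.piece j)

/-- The standard free cover: one free generator for each homogeneous element. -/
abbrev cover (M : GrMod.{u, v} k d) : GrMod.{u, max u v} k d :=
  freeGr k d (fun x : M.CoverIndex => x.down.1)

def coverMap (M : GrMod.{u, v} k d) :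
    M.cover.carrier →ₗ[CoordRing k d] M.carrier :=
  Finsupp.linearCombination (CoordRing k d) (fun x : M.CoverIndex => (x.down.2 : M.carrier))

theorem coverMap_graded (M : GrMod.{u, v} k d) : IsGradedHom M.coverMap := by
  intro j (f : M.CoverIndex →₀ CoordRing k d) hf
  have h : M.coverMap f =
      Finsupp.sum f fun x (b : CoordRing k d) => b • (x.down.2 : M.carrier) := rfl
  rw [h]
  refine Submodule.sum_mem _ fun x _ => ?_
  have := M.smul_mem (j - x.down.1) x.down.1 (f x) x.down.2 (hf x) x.down.2.2
  rwa [sub_add_cancel] at this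

theorem coverMap_surjective (M : GrMod.{u, v} k d) : Function.Surjective M.coverMap := by
  intro m
  rw [← LinearMap.mem_range]
  obtain ⟨s, hs⟩ := M.exists_sum_proj m
  rw [hs]
  refine Submodule.sum_mem _ fun j _ => ?_
  refine ⟨Finsupp.single (⟨⟨j, ⟨M.proj j m, M.proj_mem j m⟩⟩⟩ : M.CoverIndex)
    (1 : CoordRing k d), ?_⟩
  exact (Finsupp.linearCombination_single _ _ _).trans (one_smul _ _)

/-- The kernel of the standard free cover. -/
def syzygy (M : GrMod.{u, v} k d) : GrMod.{u, max u v} k d :=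
  ker M.coverMap M.coverMap_graded

/-- The inclusion of the kernel into the standard free cover. -/
def syzygyInclusion (M : GrMod.{u, v} k d) :
    M.syzygy.carrier →ₗ[CoordRing k d] M.cover.carrier :=
  (LinearMap.ker M.coverMap).subtype

/-- The iterated kernels, beginning with the first one. -/
def iterSyzygy (M : GrMod.{u, v} k d) : ℕ → GrMod.{u, max u v} k d
  | 0 => M.syzygy
  | i + 1 => (iterSyzygy M i).syzygy

/-- Index types of the standard resolution. -/
def resIndex (M : GrMod.{u, v} k d) : ℕ → Type (max u v)
  | 0 => M.CoverIndex
  | i + 1 => (M.iterSyzygy i).CoverIndex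

/-- Generator degrees of the standard resolution. -/
def resDeg (M : GrMod.{u, v} k d) : ∀ i, M.resIndex i → ℤ
  | 0 => fun x : M.CoverIndex => x.down.1
  | i + 1 => fun x : (M.iterSyzygy i).CoverIndex => x.down.1

/-- The differentials of the standard resolution. -/
def resDiff (M : GrMod.{u, v} k d) : ∀ i,
    (freeGr k d (M.resDeg (i + 1))).carrier →ₗ[CoordRing k d] (freeGr k d (M.resDeg i)).carrier
  | 0 => M.syzygyInclusion ∘ₗ M.syzygy.coverMap
  | i + 1 => (M.iterSyzygy i).syzygyInclusion ∘ₗ (M.iterSyzygy i).syzygy.coverMap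

theorem exact_cover {M : GrMod.{u, v} k d} {V : Type*} [AddCommGroup V]
    [Module (CoordRing k d) V] (g : M.carrier →ₗ[CoordRing k d] V) (hg : Function.Injective g) :
    Function.Exact (M.syzygyInclusion ∘ₗ M.syzygy.coverMap) (g ∘ₗ M.coverMap) := by
  intro y
  constructor
  · intro hy
    have hy' : M.coverMap y = 0 := hg (by simpa using hy)
    obtain ⟨z, hz⟩ := M.syzygy.coverMap_surjective ⟨y, hy'⟩
    exact ⟨z, by rw [LinearMap.comp_apply, hz]; rfl⟩
  · rintro ⟨z, rfl⟩
    have h : M.coverMap (M.syzygyInclusion (M.syzygy.coverMap z)) = 0 :=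
      LinearMap.mem_ker.1 (M.syzygy.coverMap z).2
    rw [LinearMap.comp_apply, LinearMap.comp_apply, h, map_zero]

theorem syzygyInclusion_injective (M : GrMod.{u, v} k d) :
    Function.Injective M.syzygyInclusion :=
  Subtype.val_injective

/-- The standard graded free resolution. -/
def standardResolution (M : GrMod.{u, v} k d) : GradedFreeResolution M where
  ι := M.resIndex
  deg := M.resDeg
  diff := M.resDiff
  aug := M.coverMap
  diff_graded := by
    intro i
    cases i with
    | zero => exact fun j m hm => M.syzygy.coverMap_graded j m hm
    | succ i => exact fun j m hm => (M.iterSyzygy i).syzygy.coverMap_graded j m hm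
  aug_graded := M.coverMap_graded
  aug_surjective := M.coverMap_surjective
  exact_zero := exact_cover (LinearMap.id) Function.injective_id
  exact_succ := by
    intro i
    cases i with
    | zero => exact exact_cover _ M.syzygyInclusion_injective
    | succ i => exact exact_cover _ (M.iterSyzygy i).syzygyInclusion_injective

/-- `k ⊗_B M = M / 𝔪M`. -/
abbrev Fiber (M : GrMod.{u, v} k d) : Type v :=
  M.carrier ⧸ (irrelevant k d • ⊤ : Submodule (CoordRing k d) M.carrier)

/-- The degree `j` part of `k ⊗_B M`. -/
def fiberPiece (M : GrMod.{u, v} k d) (j : ℤ) : Submodule k M.Fiber :=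
  (M.piece j).map
    ((irrelevant k d • ⊤ : Submodule (CoordRing k d) M.carrier).mkQ.restrictScalars k)

/-- The map `k ⊗_B f`. -/
def fiberMap {M : GrMod.{u, v} k d} {N : GrMod.{u, w} k d}
    (f : M.carrier →ₗ[CoordRing k d] N.carrier) : M.Fiber →ₗ[k] N.Fiber :=
  (Submodule.mapQ _ _ f (by
    rw [← Submodule.map_le_iff_le_comap, Submodule.map_smul'']
    exact Submodule.smul_mono le_rfl le_top)).restrictScalars k

end GrMod

namespace GradedFreeResolution

open GrMod

variable {M : GrMod.{u, v} k d} (F : GradedFreeResolution M)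

/-- The cycles of the complex `k ⊗_B F` in homological degree `i` and internal degree `j`. -/
def cycles : ∀ i : ℕ, ℤ → Submodule k (freeGr k d (F.deg i)).Fiber
  | 0, j => fiberPiece (freeGr k d (F.deg 0)) j
  | i + 1, j => fiberPiece (freeGr k d (F.deg (i + 1))) j ⊓ LinearMap.ker (fiberMap (F.diff i))

/-- The boundaries of the complex `k ⊗_B F` in homological degree `i` and internal degree `j`. -/
def boundaries (i : ℕ) (j : ℤ) : Submodule k (freeGr k d (F.deg i)).Fiber :=
  (fiberPiece (freeGr k d (F.deg (i + 1))) j).map (fiberMap (F.diff i))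

/-- The homology `H_i(k ⊗_B F)_j`. -/
abbrev homology (i : ℕ) (j : ℤ) : Type (max u v) :=
  F.cycles i j ⧸ (F.boundaries i j).submoduleOf (F.cycles i j)

end GradedFreeResolution

namespace GrMod

/-- `Tor_i^B(k, M)_j`, computed from the standard graded free resolution of `M`. -/
abbrev Tor (M : GrMod.{u, v} k d) (i : ℕ) (j : ℤ) : Type (max u v) :=
  M.standardResolution.homology i j

/-- The graded Betti number `β_{i,j}(M) = dim_k Tor_i^B(k, M)_j`. -/
def gradedBetti (M : GrMod.{u, v} k d) (i : ℕ) (j : ℤ) : ℕ :=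
  Module.finrank k (M.Tor i j)

/-- The (total) Betti number `β_i(M) = ∑_j β_{i,j}(M)`. -/
def betti (M : GrMod.{u, v} k d) (i : ℕ) : ℕ :=
  ∑ᶠ j : ℤ, M.gradedBetti i j

/-- `M` has a pure resolution of type `(d₀, d₁, d₂; ℓ)`: there is an exact sequence of graded
modules `0 → E₂ → F₁ → F₀ → M → 0` with `F₀ = B(-d₀)^a`, `F₁ = B(-d₁)^b`,
`E₂ = M^(ℓ)(-d₂)^r`, which is minimal, i.e. the image of `F₁` lies in `𝔪F₀` and the image of `E₂`
lies in `𝔪F₁`. -/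
def HasPureResolution (M : GrMod.{u, v} k d) (d₀ d₁ d₂ : ℤ) (ℓ : ℕ) : Prop :=
  ∃ (a b r : ℕ)
    (ε : (freeGr k d (fun _ : Fin a => d₀)).carrier →ₗ[CoordRing k d] M.carrier)
    (φ : (freeGr k d (fun _ : Fin b => d₁)).carrier →ₗ[CoordRing k d]
      (freeGr k d (fun _ : Fin a => d₀)).carrier)
    (ψ : ((mcmGr k d ℓ).copies (fun _ : Fin r => d₂)).carrier →ₗ[CoordRing k d]
      (freeGr k d (fun _ : Fin b => d₁)).carrier),
    IsGradedHom ε ∧ IsGradedHom φ ∧ IsGradedHom ψ ∧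
    Function.Surjective ε ∧ Function.Exact φ ε ∧ Function.Exact ψ φ ∧ Function.Injective ψ ∧
    LinearMap.range φ ≤ irrelevant k d • ⊤ ∧ LinearMap.range ψ ≤ irrelevant k d • ⊤

end GrMod

end RatNormal

end

noncomputable section

namespace RatNormal

/-! ### Comparison of graded free resolutions: graded `Tor` does not depend on the resolution. -/

section

/-! The key is that the third term of a pure resolution has an explicit linear resolution. Over S,
the only syzygies of the monomials x^i y^(ℓ-i) are generated by those between neighbours, y·(x^(i+1)
y^(ℓ-i-1)) = x·(x^i y^(ℓ-i)), and these are independent. Restricted to degrees congruent to ℓ mod d,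
this Koszul-type sequence becomes 0 → M^(d-1)(-1)^ℓ → B^(ℓ+1) → M^(ℓ) → 0, whose first map has
entries ±x, ±y (`strand_exact`, `strandIncl_injective`, `strandProj_surjective`). The kernel is of
the same kind with ℓ replaced by d-1, so the sequences can be spliced forever. Each splice raises
the generator degree by one, and the ranks from homological degree 2 on are r(ℓ+1), rℓd, rℓ(d-1)d,
rℓ(d-1)²d, ...

Spliced to F₁ → F₀ → M, this gives a free resolution whose differentials all map into 𝔪 times their
target (`toGradedFreeResolution`, `range_toGradedFreeResolution_le`). `Tor` is defined by a huge
standard resolution, so the comparison theorem `nonempty_homology_equiv` is needed to move to the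
minimal one. There the differentials vanish modulo 𝔪, and Betti numbers are ranks
(`gradedBetti_of_minimal`). This settles the vanishing and the formula for i ≥ 3.

The relation among a, b, r is of Herzog–Kühl type. Finite length forces M_n = 0 for large n, so the
Hilbert functions satisfy b(d(n-d₁)+1) = a(d(n-d₀)+1) + r(d(n-d₂)+ℓ+1). Comparing coefficients of n
gives two linear equations (`hilbert_equations`). Minimality gives d₀ < d₁ when M ≠ 0, hence the
positivity of the scalar (`exists_rank_eq`). -/

theorem exists_dependent_seq {α : ℕ → Type*} (p : ∀ i, α i → Prop)
    (r : ∀ i, α i → α (i + 1) → Prop) (a₀ : α 0) (h₀ : p 0 a₀)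
    (hs : ∀ i a, p i a → ∃ b, p (i + 1) b ∧ r i a b) :
    ∃ f : ∀ i, α i, f 0 = a₀ ∧ (∀ i, p i (f i)) ∧ ∀ i, r i (f i) (f (i + 1)) := by
  choose g hg using hs
  let F : ∀ i, {a : α i // p i a} := fun i =>
    Nat.rec (motive := fun i => {a : α i // p i a}) ⟨a₀, h₀⟩
      (fun i a => ⟨g i a.1 a.2, (hg i a.1 a.2).1⟩) i
  exact ⟨fun i => (F i).1, rfl, fun i => (F i).2, fun i => (hg i (F i).1 (F i).2).2⟩

variable {k : Type u} [Field k] {d : ℕ}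

namespace GrMod

theorem fiberMap_id {M : GrMod.{u, v} k d} (x : M.Fiber) : fiberMap (LinearMap.id : M.carrier →ₗ[CoordRing k d] _) x = x := by
  induction x using Submodule.Quotient.induction_on with
  | H m => rfl

universe v₁ v₂ v₃

theorem fiberMap_comp {L : GrMod.{u, v₁} k d} {M : GrMod.{u, v₂} k d} {N : GrMod.{u, v₃} k d}
    (g : M.carrier →ₗ[CoordRing k d] N.carrier) (f : L.carrier →ₗ[CoordRing k d] M.carrier)
    (x : L.Fiber) : fiberMap (g ∘ₗ f) x = fiberMap g (fiberMap f x) := by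
  induction x using Submodule.Quotient.induction_on with
  | H m => rfl

theorem fiberMap_add {M : GrMod.{u, v} k d} {N : GrMod.{u, w} k d}
    (f g : M.carrier →ₗ[CoordRing k d] N.carrier) (x : M.Fiber) :
    fiberMap (f + g) x = fiberMap f x + fiberMap g x := by
  induction x using Submodule.Quotient.induction_on with
  | H m => rfl

theorem fiberMap_sub {M : GrMod.{u, v} k d} {N : GrMod.{u, w} k d}
    (f g : M.carrier →ₗ[CoordRing k d] N.carrier) (x : M.Fiber) :
    fiberMap (f - g) x = fiberMap f x - fiberMap g x := by
  induction x using Submodule.Quotient.induction_on with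
  | H m => rfl

theorem fiberMap_mem_fiberPiece {M : GrMod.{u, v} k d} {N : GrMod.{u, w} k d}
    {f : M.carrier →ₗ[CoordRing k d] N.carrier} (hf : IsGradedHom f) {j : ℤ} {x : M.Fiber}
    (hx : x ∈ fiberPiece M j) : fiberMap f x ∈ fiberPiece N j := by
  obtain ⟨m, hm, rfl⟩ := hx
  exact ⟨f m, hf j m hm, rfl⟩

namespace IsGradedHom

theorem comp {L : GrMod.{u, v₁} k d} {M : GrMod.{u, v₂} k d} {N : GrMod.{u, v₃} k d}
    {g : M.carrier →ₗ[CoordRing k d] N.carrier} {f : L.carrier →ₗ[CoordRing k d] M.carrier}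
    (hg : IsGradedHom g) (hf : IsGradedHom f) : IsGradedHom (g ∘ₗ f) :=
  fun j m hm => hg j _ (hf j m hm)

theorem sub {M : GrMod.{u, v} k d} {N : GrMod.{u, w} k d}
    {g f : M.carrier →ₗ[CoordRing k d] N.carrier}
    (hg : IsGradedHom g) (hf : IsGradedHom f) : IsGradedHom (g - f) :=
  fun j m hm => Submodule.sub_mem _ (hg j m hm) (hf j m hm)

theorem id (M : GrMod.{u, v} k d) :
    IsGradedHom (M := M) (N := M) LinearMap.id :=
  fun _ _ hm => hm

end IsGradedHom

theorem one_mem_ringPiece : (1 : CoordRing k d) ∈ ringPiece k d 0 := by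
  intro m hm
  have h : m ∈ (1 : MvPolynomial (Fin 2) k).support := hm
  rw [← MvPolynomial.C_1, MvPolynomial.mem_support_iff, MvPolynomial.coeff_C] at h
  by_cases h0 : (0 : Fin 2 →₀ ℕ) = m
  · simp [← h0]
  · simp [h0] at h

section Free

variable [NeZero d] {ι : Type*} {e : ι → ℤ}

/-- The standard basis vector of a graded free module. -/
def freeBasis (k : Type u) [Field k] (d : ℕ) [NeZero d] {ι : Type*} (e : ι → ℤ) (x : ι) :
    (freeGr k d e).carrier :=
  Finsupp.single x (1 : CoordRing k d)

theorem freeBasis_mem (x : ι) : freeBasis k d e x ∈ (freeGr k d e).piece (e x) := by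
  intro y
  change (Finsupp.single x (1 : CoordRing k d) : ι →₀ CoordRing k d) y ∈ ringPiece k d (e x - e y)
  by_cases h : x = y
  · subst h
    rw [Finsupp.single_eq_same, sub_self]
    exact one_mem_ringPiece
  · rw [Finsupp.single_eq_of_ne' h]
    exact Submodule.zero_mem _

theorem free_hom_ext {V : Type*} [AddCommGroup V] [Module (CoordRing k d) V]
    {f g : (freeGr k d e).carrier →ₗ[CoordRing k d] V}
    (h : ∀ x, f (freeBasis k d e x) = g (freeBasis k d e x)) : f = g :=
  Finsupp.lhom_ext' (R := CoordRing k d) (M := CoordRing k d) (N := V) (α := ι)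
    fun x => LinearMap.ext_ring (h x)

/-- The graded map from a graded free module with given values on the basis. -/
def freeLift {N : GrMod.{u, v} k d} (n : ι → N.carrier) :
    (freeGr k d e).carrier →ₗ[CoordRing k d] N.carrier :=
  Finsupp.linearCombination (CoordRing k d) n

theorem freeLift_basis {N : GrMod.{u, v} k d} (n : ι → N.carrier) (x : ι) :
    freeLift (e := e) n (freeBasis k d e x) = n x :=
  (Finsupp.linearCombination_single _ _ _).trans (one_smul _ _)

theorem freeLift_graded {N : GrMod.{u, v} k d} {n : ι → N.carrier}
    (hn : ∀ x, n x ∈ N.piece (e x)) : IsGradedHom (freeLift (e := e) n) := by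
  intro j (f : ι →₀ CoordRing k d) hf
  have h : freeLift (e := e) n f = Finsupp.sum f fun x (b : CoordRing k d) => b • n x := rfl
  rw [h]
  refine Submodule.sum_mem _ fun x _ => ?_
  have := N.smul_mem (j - e x) (e x) (f x) (n x) (hf x) (hn x)
  rwa [sub_add_cancel] at this

/-- Graded projectivity of free modules. An arbitrary preimage of a basis vector's image is replaced
by its component in the degree of that basis vector; this is still a preimage because graded maps
commute with projections. -/
theorem exists_graded_lift {A : GrMod.{u, v₁} k d} {N : GrMod.{u, v₂} k d}
    {δ : A.carrier →ₗ[CoordRing k d] N.carrier} (hδ : IsGradedHom δ)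
    {h : (freeGr k d e).carrier →ₗ[CoordRing k d] N.carrier} (hh : IsGradedHom h)
    (hr : ∀ z, ∃ a, δ a = h z) :
    ∃ h' : (freeGr k d e).carrier →ₗ[CoordRing k d] A.carrier, IsGradedHom h' ∧ δ ∘ₗ h' = h := by
  choose a ha using fun x => hr (freeBasis k d e x)
  refine ⟨freeLift fun x => A.proj (e x) (a x), freeLift_graded fun x => A.proj_mem _ _,
    free_hom_ext fun x => ?_⟩
  rw [LinearMap.comp_apply, freeLift_basis, ← proj_apply_of_isGradedHom hδ, ha]
  exact N.proj_of_mem (hh _ _ (freeBasis_mem x))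

end Free

end GrMod

namespace GradedFreeResolution

open GrMod

variable [NeZero d] {M : GrMod.{u, v} k d}

theorem exists_chain_map (F P : GradedFreeResolution M) :
    ∃ f : ∀ i, (freeGr k d (F.deg i)).carrier →ₗ[CoordRing k d] (freeGr k d (P.deg i)).carrier,
      (∀ i, IsGradedHom (f i)) ∧ P.aug ∘ₗ f 0 = F.aug ∧
        ∀ i, P.diff i ∘ₗ f (i + 1) = f i ∘ₗ F.diff i := by
  obtain ⟨f₀, hf₀, hf₀'⟩ := exists_graded_lift P.aug_graded F.aug_graded
    fun z => P.aug_surjective (F.aug z)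
  obtain ⟨f, h0, hp, hr⟩ := exists_dependent_seq
    (α := fun i => (freeGr k d (F.deg i)).carrier →ₗ[CoordRing k d] (freeGr k d (P.deg i)).carrier)
    -- The invariant carries the range condition under which the next lift exists; exactness of `P`
    -- renews it at each stage.
    (fun i f => IsGradedHom f ∧ ∀ z, ∃ a, P.diff i a = (f ∘ₗ F.diff i) z)
    (fun i f f' => P.diff i ∘ₗ f' = f ∘ₗ F.diff i) f₀ ⟨hf₀, fun z => by
      refine (P.exact_zero _).1 ?_
      rw [LinearMap.comp_apply, ← LinearMap.comp_apply P.aug, hf₀']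
      exact (F.exact_zero _).2 ⟨z, rfl⟩⟩ (by
      rintro i f ⟨hf, hz⟩
      obtain ⟨f', hf', he⟩ := exists_graded_lift (P.diff_graded i) (hf.comp (F.diff_graded i)) hz
      refine ⟨f', ⟨hf', fun z => (P.exact_succ i _).1 ?_⟩, he⟩
      rw [LinearMap.comp_apply, ← LinearMap.comp_apply (P.diff i), he, LinearMap.comp_apply,
        (F.exact_succ i _).2 ⟨z, rfl⟩, map_zero])
  exact ⟨f, fun i => (hp i).1, h0 ▸ hf₀', hr⟩

/-- A chain endomorphism covering zero is null-homotopic: each h_{i+1} - s_i ∂ takes values in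
cycles, hence in boundaries by exactness, and so lifts to s_{i+1}. -/
theorem exists_homotopy (P : GradedFreeResolution M)
    (h : ∀ i, (freeGr k d (P.deg i)).carrier →ₗ[CoordRing k d] (freeGr k d (P.deg i)).carrier)
    (hg : ∀ i, IsGradedHom (h i)) (h0 : P.aug ∘ₗ h 0 = 0)
    (hc : ∀ i, P.diff i ∘ₗ h (i + 1) = h i ∘ₗ P.diff i) :
    ∃ s : ∀ i, (freeGr k d (P.deg i)).carrier →ₗ[CoordRing k d]
        (freeGr k d (P.deg (i + 1))).carrier,
      (∀ i, IsGradedHom (s i)) ∧ h 0 = P.diff 0 ∘ₗ s 0 ∧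
        ∀ i, h (i + 1) = P.diff (i + 1) ∘ₗ s (i + 1) + s i ∘ₗ P.diff i := by
  obtain ⟨s₀, hs₀, hs₀'⟩ := exists_graded_lift (P.diff_graded 0) (hg 0)
    fun z => (P.exact_zero _).1 (LinearMap.congr_fun h0 z)
  obtain ⟨s, h0, hp, hr⟩ := exists_dependent_seq
    (α := fun i => (freeGr k d (P.deg i)).carrier →ₗ[CoordRing k d]
      (freeGr k d (P.deg (i + 1))).carrier)
    (fun i s => IsGradedHom s ∧ ∀ z, P.diff i ((h (i + 1) - s ∘ₗ P.diff i) z) = 0)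
    (fun i s s' => P.diff (i + 1) ∘ₗ s' = h (i + 1) - s ∘ₗ P.diff i) s₀ ⟨hs₀, fun z => by
      rw [LinearMap.sub_apply, map_sub, ← LinearMap.comp_apply, hc, LinearMap.comp_apply s₀,
        ← LinearMap.comp_apply (P.diff 0) s₀, hs₀', LinearMap.comp_apply, sub_self]⟩ (by
      rintro i s ⟨hs, hz⟩
      obtain ⟨s', hs', he⟩ := exists_graded_lift (P.diff_graded (i + 1))
        ((hg (i + 1)).sub (hs.comp (P.diff_graded i))) fun z => (P.exact_succ i _).1 (hz z)
      refine ⟨s', ⟨hs', fun z => ?_⟩, he⟩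
      rw [LinearMap.sub_apply, map_sub, ← LinearMap.comp_apply, hc, LinearMap.comp_apply s',
        ← LinearMap.comp_apply (P.diff (i + 1)) s', he, LinearMap.comp_apply,
        LinearMap.sub_apply, LinearMap.comp_apply s, (P.exact_succ i _).2 ⟨z, rfl⟩, map_zero,
        sub_zero, sub_self])
  refine ⟨s, fun i => (hp i).1, ?_, fun i => ?_⟩
  · rw [h0, hs₀']
  · rw [hr, sub_add_cancel]

theorem mem_cycles_iff (F : GradedFreeResolution M) (i : ℕ) (j : ℤ)
    (x : (freeGr k d (F.deg (i + 1))).Fiber) :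
    x ∈ F.cycles (i + 1) j ↔
      x ∈ fiberPiece (freeGr k d (F.deg (i + 1))) j ∧ fiberMap (F.diff i) x = 0 := Iff.rfl

section

variable {F P : GradedFreeResolution M}
  {f : ∀ i, (freeGr k d (F.deg i)).carrier →ₗ[CoordRing k d] (freeGr k d (P.deg i)).carrier}

theorem fiberMap_mem_cycles (hf : ∀ i, IsGradedHom (f i))
    (hc : ∀ i, P.diff i ∘ₗ f (i + 1) = f i ∘ₗ F.diff i) (i : ℕ) (j : ℤ)
    {x : (freeGr k d (F.deg i)).Fiber} (hx : x ∈ F.cycles i j) :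
    fiberMap (f i) x ∈ P.cycles i j := by
  cases i with
  | zero => exact fiberMap_mem_fiberPiece (hf 0) hx
  | succ i =>
    rw [mem_cycles_iff] at hx ⊢
    refine ⟨fiberMap_mem_fiberPiece (hf _) hx.1, ?_⟩
    rw [← fiberMap_comp, hc, fiberMap_comp, hx.2, map_zero]

theorem fiberMap_mem_boundaries (hf : ∀ i, IsGradedHom (f i))
    (hc : ∀ i, P.diff i ∘ₗ f (i + 1) = f i ∘ₗ F.diff i) (i : ℕ) (j : ℤ)
    {x : (freeGr k d (F.deg i)).Fiber} (hx : x ∈ F.boundaries i j) :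
    fiberMap (f i) x ∈ P.boundaries i j := by
  obtain ⟨y, hy, rfl⟩ := hx
  refine ⟨fiberMap (f (i + 1)) y, fiberMap_mem_fiberPiece (hf _) hy, ?_⟩
  rw [← fiberMap_comp, hc, fiberMap_comp]

/-- The map on the homology of `k ⊗_B F` induced by a chain map. -/
def homologyMap (hf : ∀ i, IsGradedHom (f i))
    (hc : ∀ i, P.diff i ∘ₗ f (i + 1) = f i ∘ₗ F.diff i) (i : ℕ) (j : ℤ) :
    F.homology i j →ₗ[k] P.homology i j :=
  Submodule.mapQ _ _ ((fiberMap (f i)).restrict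
    fun _ hx => fiberMap_mem_cycles hf hc i j hx) fun _ hx => fiberMap_mem_boundaries hf hc i j hx

end

/-- Applied to the composite of two comparison maps, this shows that they are mutually inverse on
homology. -/
theorem sub_fiberMap_mem_boundaries {P : GradedFreeResolution M}
    {h : ∀ i, (freeGr k d (P.deg i)).carrier →ₗ[CoordRing k d] (freeGr k d (P.deg i)).carrier}
    (hg : ∀ i, IsGradedHom (h i)) (h0 : P.aug ∘ₗ h 0 = P.aug)
    (hc : ∀ i, P.diff i ∘ₗ h (i + 1) = h i ∘ₗ P.diff i) (i : ℕ) (j : ℤ)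
    {x : (freeGr k d (P.deg i)).Fiber} (hx : x ∈ P.cycles i j) :
    fiberMap (h i) x - x ∈ P.boundaries i j := by
  obtain ⟨s, hs, hs0, hs1⟩ := exists_homotopy P (fun i => h i - LinearMap.id)
    (fun i => (hg i).sub (IsGradedHom.id _))
    (by rw [LinearMap.comp_sub, h0, LinearMap.comp_id, sub_self])
    (fun i => by rw [LinearMap.comp_sub, LinearMap.sub_comp, hc]; rfl)
  have key : fiberMap (h i) x - x = fiberMap (h i - LinearMap.id) x := by
    rw [fiberMap_sub, fiberMap_id]
  rw [key]
  cases i with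
  | zero =>
    rw [hs0, fiberMap_comp]
    exact ⟨_, fiberMap_mem_fiberPiece (hs 0) hx, rfl⟩
  | succ i =>
    rw [mem_cycles_iff] at hx
    -- The term s∂ of the homotopy dies because x is a cycle; the term ∂s is a boundary.
    rw [hs1, fiberMap_add, fiberMap_comp, fiberMap_comp, hx.2, map_zero, add_zero]
    exact ⟨_, fiberMap_mem_fiberPiece (hs _) hx.1, rfl⟩

theorem homologyMap_comp_homologyMap {F P : GradedFreeResolution M}
    {f : ∀ i, (freeGr k d (F.deg i)).carrier →ₗ[CoordRing k d] (freeGr k d (P.deg i)).carrier}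
    {g : ∀ i, (freeGr k d (P.deg i)).carrier →ₗ[CoordRing k d] (freeGr k d (F.deg i)).carrier}
    (hf : ∀ i, IsGradedHom (f i)) (hf0 : P.aug ∘ₗ f 0 = F.aug)
    (hfc : ∀ i, P.diff i ∘ₗ f (i + 1) = f i ∘ₗ F.diff i)
    (hg : ∀ i, IsGradedHom (g i)) (hg0 : F.aug ∘ₗ g 0 = P.aug)
    (hgc : ∀ i, F.diff i ∘ₗ g (i + 1) = g i ∘ₗ P.diff i) (i : ℕ) (j : ℤ) :
    homologyMap hg hgc i j ∘ₗ homologyMap hf hfc i j = LinearMap.id := by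
  ext x
  refine (Submodule.Quotient.eq _).2 ?_
  have := sub_fiberMap_mem_boundaries (P := F) (h := fun i => g i ∘ₗ f i)
    (fun i => (hg i).comp (hf i)) (by rw [← LinearMap.comp_assoc, hg0, hf0])
    (fun i => by
      rw [← LinearMap.comp_assoc, hgc, LinearMap.comp_assoc, hfc, LinearMap.comp_assoc]) i j x.2
  rwa [fiberMap_comp] at this

/-- Graded `Tor` may be computed from any graded free resolution. -/
theorem nonempty_homology_equiv (F P : GradedFreeResolution M) (i : ℕ) (j : ℤ) :
    Nonempty (F.homology i j ≃ₗ[k] P.homology i j) := by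
  obtain ⟨f, hf, hf0, hfc⟩ := exists_chain_map F P
  obtain ⟨g, hg, hg0, hgc⟩ := exists_chain_map P F
  exact ⟨LinearEquiv.ofLinearMap (homologyMap hf hfc i j) (homologyMap hg hgc i j)
    (homologyMap_comp_homologyMap hg hg0 hgc hf hf0 hfc i j)
    (homologyMap_comp_homologyMap hf hf0 hfc hg hg0 hgc i j)⟩

end GradedFreeResolution

end

/-! ### Fibers of graded free modules, and Betti numbers read off a minimal resolution. -/

section

open GrMod

variable {k : Type u} [Field k] {d : ℕ}

theorem mem_irrelevant_iff (b : CoordRing k d) :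
    b ∈ irrelevant k d ↔ MvPolynomial.constantCoeff (incl k d b) = 0 := Iff.rfl

theorem mem_irrelevant_of_mem_ringPiece [NeZero d] {n : ℤ} (hn : n ≠ 0) {b : CoordRing k d}
    (hb : b ∈ ringPiece k d n) : b ∈ irrelevant k d := by
  rw [mem_irrelevant_iff, MvPolynomial.constantCoeff_eq]
  by_contra h
  have h1 : ((0 : Fin 2 →₀ ℕ).degree : ℤ) = d * n := hb 0 (MvPolynomial.mem_support_iff.2 h)
  simp [NeZero.ne d, hn] at h1

theorem algebraMap_mem_irrelevant_iff (c : k) :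
    algebraMap k (CoordRing k d) c ∈ irrelevant k d ↔ c = 0 := by
  rw [mem_irrelevant_iff, AlgHom.commutes]
  simp [MvPolynomial.algebraMap_eq]

theorem sub_algebraMap_mem_irrelevant (b : CoordRing k d) :
    b - algebraMap k (CoordRing k d) (MvPolynomial.constantCoeff (incl k d b)) ∈
      irrelevant k d := by
  rw [mem_irrelevant_iff, map_sub, map_sub, AlgHom.commutes]
  simp [MvPolynomial.algebraMap_eq]

theorem algebraMap_mem_ringPiece (c : k) : algebraMap k (CoordRing k d) c ∈ ringPiece k d 0 := by
  rw [Algebra.algebraMap_eq_smul_one]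
  exact Submodule.smul_mem _ _ one_mem_ringPiece

theorem fiberMap_eq_zero_of_range_le {M : GrMod.{u, v} k d} {N : GrMod.{u, w} k d}
    {f : M.carrier →ₗ[CoordRing k d] N.carrier} (hf : LinearMap.range f ≤ irrelevant k d • ⊤) :
    fiberMap f = 0 := by
  refine LinearMap.ext fun x => ?_
  induction x using Submodule.Quotient.induction_on with
  | H m => exact (Submodule.Quotient.mk_eq_zero _).2 (hf ⟨m, rfl⟩)

section Free

variable [NeZero d] {ι : Type*} {e : ι → ℤ}

/-- Makes every minimality condition a check on entries. -/
theorem mem_irrelevant_smul_top_iff (f : ι →₀ CoordRing k d) :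
    f ∈ (irrelevant k d • ⊤ : Submodule (CoordRing k d) (freeGr k d e).carrier) ↔
      ∀ x, f x ∈ irrelevant k d := by
  constructor
  · intro hf
    refine Submodule.smul_induction_on (p := fun f : (freeGr k d e).carrier =>
      ∀ x, (show ι →₀ CoordRing k d from f) x ∈ irrelevant k d) hf ?_ ?_
    · intro b hb (g : ι →₀ CoordRing k d) _ x
      exact Ideal.mul_mem_right (g x) _ hb
    · intro g h hg hh x
      exact Ideal.add_mem _ (hg x) (hh x)
  · intro hf
    have h : f = f.sum fun x b => b • (Finsupp.single x (1 : CoordRing k d)) := by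
      simp [Finsupp.smul_single]
    rw [h]
    exact Submodule.sum_mem (irrelevant k d • ⊤ : Submodule (CoordRing k d)
      (freeGr k d e).carrier) fun x _ => Submodule.smul_mem_smul (hf x) trivial

/-- The classes of the `k`-linear combinations of the basis vectors in the fiber of a graded free
module. -/
def constToFiber (k : Type u) [Field k] (d : ℕ) [NeZero d] {ι : Type*} (e : ι → ℤ) :
    (ι →₀ k) →ₗ[k] (freeGr k d e).Fiber :=
  ((irrelevant k d • ⊤ : Submodule (CoordRing k d)
    (freeGr k d e).carrier).mkQ.restrictScalars k) ∘ₗ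
    (Finsupp.mapRange.linearMap (Algebra.linearMap k (CoordRing k d)) :
      (ι →₀ k) →ₗ[k] (ι →₀ CoordRing k d))

theorem constToFiber_injective : Function.Injective (constToFiber k d e) := by
  rw [injective_iff_map_eq_zero]
  intro v hv
  have h := (mem_irrelevant_smul_top_iff (e := e) _).1 ((Submodule.Quotient.mk_eq_zero _).1 hv)
  ext x
  exact (algebraMap_mem_irrelevant_iff (d := d) _).1 (h x)

theorem range_constToFiber {D : ℤ} (he : ∀ x, e x = D) :
    LinearMap.range (constToFiber k d e) = fiberPiece (freeGr k d e) D := by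
  apply le_antisymm
  · rintro _ ⟨v, rfl⟩
    refine ⟨_, fun x => ?_, rfl⟩
    rw [he, sub_self]
    exact algebraMap_mem_ringPiece (v x)
  -- The degree of `f` plays no role: each entry is congruent to its constant term modulo 𝔪.
  · rintro _ ⟨f, -, rfl⟩
    refine ⟨Finsupp.mapRange (fun b => MvPolynomial.constantCoeff (incl k d b)) (by simp)
      (show ι →₀ CoordRing k d from f), ?_⟩
    refine Eq.symm ((Submodule.Quotient.eq _).2 ?_)
    exact (mem_irrelevant_smul_top_iff (e := e) _).2 fun x => sub_algebraMap_mem_irrelevant _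

/-- The entries of a degree j element have degree j - D ≠ 0, so they lie in 𝔪. -/
theorem fiberPiece_freeGr_eq_bot {D j : ℤ} (he : ∀ x, e x = D) (hj : j ≠ D) :
    fiberPiece (freeGr k d e) j = ⊥ := by
  rw [eq_bot_iff]
  rintro _ ⟨f, hf, rfl⟩
  refine (Submodule.Quotient.mk_eq_zero _).2 ((mem_irrelevant_smul_top_iff (e := e) f).2 fun x => ?_)
  exact mem_irrelevant_of_mem_ringPiece (by rw [he]; exact sub_ne_zero.2 hj) (hf x)

theorem finite_fiberPiece_freeGr [Finite ι] {D : ℤ} (he : ∀ x, e x = D) (j : ℤ) :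
    Module.Finite k (fiberPiece (freeGr k d e) j) := by
  by_cases hj : j = D
  · rw [hj, ← range_constToFiber he]
    infer_instance
  · rw [fiberPiece_freeGr_eq_bot he hj]
    infer_instance

theorem finrank_fiberPiece_freeGr [Finite ι] {D : ℤ} (he : ∀ x, e x = D) (j : ℤ) :
    Module.finrank k (fiberPiece (freeGr k d e) j) = if j = D then Nat.card ι else 0 := by
  split_ifs with hj
  · have := Fintype.ofFinite ι
    rw [hj, ← range_constToFiber he, LinearMap.finrank_range_of_inj constToFiber_injective,
      Module.finrank_finsupp_self, Nat.card_eq_fintype_card]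
  · rw [fiberPiece_freeGr_eq_bot he hj, finrank_bot]

end Free

namespace GradedFreeResolution

variable [NeZero d] {M : GrMod.{u, v} k d}

/-- By minimality all differentials of k ⊗ P vanish, so everything is a cycle and only 0 is a
boundary. -/
theorem nonempty_homology_equiv_fiberPiece (P : GradedFreeResolution M)
    (hmin : ∀ i, LinearMap.range (P.diff i) ≤ irrelevant k d • ⊤) (i : ℕ) (j : ℤ) :
    Nonempty (P.homology i j ≃ₗ[k] fiberPiece (freeGr k d (P.deg i)) j) := by
  have h0 : ∀ i, fiberMap (P.diff i) = 0 := fun i => fiberMap_eq_zero_of_range_le (hmin i)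
  have hc : P.cycles i j = fiberPiece (freeGr k d (P.deg i)) j := by
    cases i with
    | zero => rfl
    | succ i =>
      change _ ⊓ LinearMap.ker (fiberMap (P.diff i)) = _
      rw [h0, LinearMap.ker_zero, inf_top_eq]
  have hb : P.boundaries i j = ⊥ := by
    change Submodule.map _ _ = _
    rw [h0, Submodule.map_zero]
  refine ⟨(Submodule.quotEquivOfEqBot _ ?_).trans (LinearEquiv.ofEq _ _ hc)⟩
  rw [hb]
  exact LinearMap.ker_eq_bot.2 (Submodule.subtype_injective _)

theorem finite_tor_of_minimal (P : GradedFreeResolution M)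
    (hmin : ∀ i, LinearMap.range (P.diff i) ≤ irrelevant k d • ⊤)
    [∀ i, Finite (P.ι i)] {D : ℕ → ℤ} (hdeg : ∀ i x, P.deg i x = D i) (i : ℕ) (j : ℤ) : Module.Finite k (M.Tor i j) := by
  obtain ⟨e₁⟩ := nonempty_homology_equiv M.standardResolution P i j
  obtain ⟨e₂⟩ := nonempty_homology_equiv_fiberPiece P hmin i j
  have := finite_fiberPiece_freeGr (k := k) (d := d) (hdeg i) j
  exact Module.Finite.equiv (e₁.trans e₂).symm

theorem gradedBetti_of_minimal (P : GradedFreeResolution M)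
    (hmin : ∀ i, LinearMap.range (P.diff i) ≤ irrelevant k d • ⊤)
    [∀ i, Finite (P.ι i)] {D : ℕ → ℤ} (hdeg : ∀ i x, P.deg i x = D i) (i : ℕ) (j : ℤ) :
    M.gradedBetti i j = if j = D i then Nat.card (P.ι i) else 0 := by
  obtain ⟨e₁⟩ := nonempty_homology_equiv M.standardResolution P i j
  obtain ⟨e₂⟩ := nonempty_homology_equiv_fiberPiece P hmin i j
  rw [← finrank_fiberPiece_freeGr (k := k) (d := d) (hdeg i) j]
  exact (e₁.trans e₂).finrank_eq

theorem betti_of_minimal (P : GradedFreeResolution M)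
    (hmin : ∀ i, LinearMap.range (P.diff i) ≤ irrelevant k d • ⊤)
    [∀ i, Finite (P.ι i)] {D : ℕ → ℤ} (hdeg : ∀ i x, P.deg i x = D i) (i : ℕ) : M.betti i = Nat.card (P.ι i) := by
  rw [GrMod.betti, finsum_eq_single _ (D i), gradedBetti_of_minimal P hmin hdeg, if_pos rfl]
  intro j hj
  rw [gradedBetti_of_minimal P hmin hdeg, if_neg hj]

end GradedFreeResolution

end

/-! ### Monomial generators of M^(ℓ) and their Koszul syzygies, first as identities in S. -/

section

open GrMod

variable {k : Type u} [Field k] {d : ℕ}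

section Polynomials

open MvPolynomial

/-- Degrees nd + (d-1) are exactly those one below a positive multiple of d. This is why the
syzygies consist of copies of M^(d-1). -/
theorem X_mul_mem_coordSubalgebra_iff [NeZero d] (s : Fin 2) (p : MvPolynomial (Fin 2) k) :
    X s * p ∈ coordSubalgebra k d ↔ p ∈ mcmSubmodule k d (d - 1) := by
  classical
  have hd : 0 < d := Nat.pos_of_ne_zero (NeZero.ne d)
  constructor
  · intro h m hm
    obtain ⟨n, hn⟩ := h (Finsupp.single s 1 + m) (by
      rw [support_X_mul]
      exact Finset.mem_map.2 ⟨m, hm, rfl⟩)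
    rw [map_add, Finsupp.degree_single] at hn
    obtain _ | n := n
    · omega
    · refine ⟨n, ?_⟩
      rw [add_mul] at hn
      omega
  · intro h m hm
    rw [support_X_mul] at hm
    obtain ⟨m', hm', rfl⟩ := Finset.mem_map.1 hm
    obtain ⟨n, hn⟩ := h m' hm'
    refine ⟨n + 1, ?_⟩
    change (Finsupp.single s 1 + m').degree = _
    rw [map_add, Finsupp.degree_single, hn, add_mul]
    omega

theorem X_mem_forms (s : Fin 2) : (X s : MvPolynomial (Fin 2) k) ∈ forms k 1 := by
  intro m hm
  rw [support_X, Finset.mem_singleton] at hm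
  rw [hm, Finsupp.degree_single, Nat.cast_one]

theorem X_pow_mul_X_pow_eq_monomial (i j : ℕ) :
    (X 0 ^ i * X 1 ^ j : MvPolynomial (Fin 2) k) =
      monomial (Finsupp.single 0 i + Finsupp.single 1 j) 1 := by
  rw [X_pow_eq_monomial, X_pow_eq_monomial, monomial_mul, one_mul]

theorem degree_single_add_single (i j : ℕ) :
    (Finsupp.single (0 : Fin 2) i + Finsupp.single 1 j).degree = i + j := by
  rw [map_add, Finsupp.degree_single, Finsupp.degree_single]

/-- The monomials `x^i y^(ℓ-i)` generate `M^(ℓ)` over `B`. -/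
theorem exists_sum_mul_monomial (ℓ : ℕ) {q : MvPolynomial (Fin 2) k}
    (hq : q ∈ mcmSubmodule k d ℓ) :
    ∃ f : Fin (ℓ + 1) → MvPolynomial (Fin 2) k, (∀ i, f i ∈ coordSubalgebra k d) ∧
      ∑ i, f i * (X 0 ^ (i : ℕ) * X 1 ^ (ℓ - i)) = q := by
  classical
  rw [← support_sum_monomial_coeff q]
  refine Finset.sum_induction _ (fun q => ∃ f : Fin (ℓ + 1) → MvPolynomial (Fin 2) k,
    (∀ i, f i ∈ coordSubalgebra k d) ∧ ∑ i, f i * (X 0 ^ (i : ℕ) * X 1 ^ (ℓ - i)) = q) ?_ ?_ ?_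
  · rintro _ _ ⟨f, hf, rfl⟩ ⟨g, hg, rfl⟩
    exact ⟨f + g, fun i => add_mem (hf i) (hg i), by
      simp only [Pi.add_apply, add_mul, Finset.sum_add_distrib]⟩
  · exact ⟨0, fun i => zero_mem _, by simp⟩
  · intro m hm
    obtain ⟨n, hn⟩ := hq m hm
    have hm' : m 0 + m 1 = n * d + ℓ := by
      rw [← hn, Finsupp.degree_eq_sum, Fin.sum_univ_two]
    -- As much of x as fits into degree ℓ is split off. The remaining ℓ - i factors y divide m
    -- because the degree of m is at least ℓ, and the cofactor has degree nd.
    let i : Fin (ℓ + 1) := ⟨min (m 0) ℓ, by omega⟩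
    have hle : Finsupp.single 0 (i : ℕ) + Finsupp.single 1 (ℓ - i) ≤ m := by
      intro s
      fin_cases s <;> simp [i]
      omega
    obtain ⟨m', hadd⟩ := exists_add_of_le hle
    refine ⟨Pi.single i (monomial m' (q.coeff m)), fun i' => ?_, ?_⟩
    · by_cases h : i' = i
      · subst h
        rw [Pi.single_eq_same]
        intro a ha
        have : a = m' := by simpa using support_monomial_subset ha
        refine ⟨n, ?_⟩
        have hdeg := congrArg Finsupp.degree hadd
        rw [map_add, degree_single_add_single, hn] at hdeg
        have := i.2
        rw [‹a = m'›]
        omega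
      · rw [Pi.single_eq_of_ne h]
        exact zero_mem _
    · rw [Finset.sum_eq_single i]
      · rw [Pi.single_eq_same, X_pow_mul_X_pow_eq_monomial, monomial_mul, mul_one, add_comm m', ← hadd]
      · intro j _ hj
        rw [Pi.single_eq_of_ne hj, zero_mul]
      · simp

/-- `Fin.cons` and `Fin.snoc` encode g_{j-1} and g_j with zeros at the two ends. The sum telescopes,
since y·x^(j+1)y^(ℓ-j-1) = x·x^j y^(ℓ-j). -/
theorem sum_koszul_eq_zero {R : Type*} [CommRing R] (x y : R) (ℓ : ℕ) (g : Fin ℓ → R) :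
    ∑ j : Fin (ℓ + 1), (y * Fin.cons (α := fun _ => R) 0 g j -
      x * Fin.snoc (α := fun _ => R) g 0 j) * (x ^ (j : ℕ) * y ^ (ℓ - j)) = 0 := by
  simp only [sub_mul, Finset.sum_sub_distrib]
  rw [sub_eq_zero, Fin.sum_univ_succ, Fin.sum_univ_castSucc (n := ℓ)]
  simp only [Fin.cons_zero, Fin.cons_succ, Fin.snoc_castSucc, Fin.snoc_last, mul_zero, zero_mul,
    zero_add, add_zero, Fin.val_succ, Fin.val_castSucc]
  refine Finset.sum_congr rfl fun i _ => ?_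
  have : ℓ - (i : ℕ) = ℓ - (i + 1) + 1 := by omega
  rw [this]
  ring

theorem not_X_dvd_X_pow (n : ℕ) : ¬ (X 0 : MvPolynomial (Fin 2) k) ∣ X 1 ^ n := by
  intro h
  have := X_dvd_X.1 (X_prime.dvd_of_dvd_pow h)
  simp at this

/-- Every relation among the monomials is a Koszul one, by induction on ℓ. Modulo x only f_0 y^ℓ
survives, so f_0 = xh when ℓ ≥ 1. That term is pushed into the next coefficient, and a factor x is
cancelled from the whole relation. -/
theorem exists_koszul_of_sum_eq_zero [NeZero d] (ℓ : ℕ) (f : Fin (ℓ + 1) → MvPolynomial (Fin 2) k)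
    (hf : ∀ i, f i ∈ coordSubalgebra k d)
    (hs : ∑ i, f i * (X 0 ^ (i : ℕ) * X 1 ^ (ℓ - i)) = 0) :
    ∃ g : Fin ℓ → MvPolynomial (Fin 2) k, (∀ i, g i ∈ mcmSubmodule k d (d - 1)) ∧
      ∀ j, f j = X 1 * Fin.cons (α := fun _ => MvPolynomial (Fin 2) k) 0 g j -
        X 0 * Fin.snoc (α := fun _ => MvPolynomial (Fin 2) k) g 0 j := by
  induction ℓ with
  | zero =>
    refine ⟨Fin.elim0, fun i => i.elim0, fun j => ?_⟩
    rw [Fin.sum_univ_one] at hs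
    obtain rfl : j = 0 := Fin.fin_one_eq_zero j
    have h0 : Fin.snoc (α := fun _ => MvPolynomial (Fin 2) k) Fin.elim0 0 (0 : Fin 1) = 0 :=
      Fin.snoc_last (α := fun _ => MvPolynomial (Fin 2) k) _ _
    rw [h0]
    simpa using hs
  | succ ℓ ih =>
    rw [Fin.sum_univ_succ] at hs
    have hx : (X 0 : MvPolynomial (Fin 2) k) ∣ f 0 := by
      have h1 : (X 0 : MvPolynomial (Fin 2) k) ∣ f 0 * X 1 ^ (ℓ + 1) := by
        refine (dvd_add_left (a := X 0) (b := f 0 * X 1 ^ (ℓ + 1))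
          (c := ∑ i : Fin (ℓ + 1), f i.succ * (X 0 ^ (i.succ : ℕ) * X 1 ^ (ℓ + 1 - i.succ)))
          (Finset.dvd_sum fun i _ => ?_)).1 ?_
        · rw [Fin.val_succ, pow_succ']
          exact ⟨f i.succ * (X 0 ^ (i : ℕ) * X 1 ^ (ℓ + 1 - (i + 1))), by ring⟩
        · have : f 0 * (X 0 ^ ((0 : Fin (ℓ + 2)) : ℕ) * X 1 ^ (ℓ + 1 - ((0 : Fin (ℓ + 2)) : ℕ))) =
              f 0 * X 1 ^ (ℓ + 1) := by simp
          rw [← this, hs]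
          exact dvd_zero _
      exact (X_prime.dvd_or_dvd h1).resolve_right (not_X_dvd_X_pow _)
    obtain ⟨h, hh⟩ := hx
    have hmem : h ∈ mcmSubmodule k d (d - 1) :=
      (X_mul_mem_coordSubalgebra_iff 0 h).1 (hh ▸ hf 0)
    -- After division by x, the term xh·y^(ℓ+1) becomes (yh)·y^ℓ, which joins the coefficient of
    -- y^ℓ.
    obtain ⟨g, hg, hfg⟩ := ih (fun i => f i.succ + if i = 0 then X 1 * h else 0)
      (fun i => add_mem (hf _) (by
        split_ifs
        · exact (X_mul_mem_coordSubalgebra_iff 1 h).2 hmem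
        · exact zero_mem _)) (by
      refine (mul_eq_zero.1 ?_).resolve_left (X_ne_zero (R := k) (0 : Fin 2))
      have h1 : ∑ i : Fin (ℓ + 1), (f i.succ + if i = 0 then X 1 * h else 0) *
          (X 0 ^ (i : ℕ) * X 1 ^ (ℓ - i)) =
          ∑ i : Fin (ℓ + 1), f i.succ * (X 0 ^ (i : ℕ) * X 1 ^ (ℓ - i)) + X 1 * h * X 1 ^ ℓ := by
        simp [add_mul, Finset.sum_add_distrib, ite_mul]
      refine Eq.trans ?_ hs
      rw [hh, h1, mul_add, Finset.mul_sum, add_comm]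
      congr 1
      · simp only [Fin.val_zero, pow_zero, Nat.sub_zero]
        ring
      · refine Finset.sum_congr rfl fun i _ => ?_
        rw [Fin.val_succ, Nat.add_sub_add_right]
        ring)
    -- The sign comes from f_0 = -x g_0; the coordinate after it then absorbs the correction yh.
    refine ⟨Fin.cons (-h) g, fun i => ?_, fun j => ?_⟩
    · refine Fin.cases ?_ (fun i => ?_) i
      · exact neg_mem hmem
      · exact hg i
    · rw [← Fin.cons_snoc_eq_snoc_cons]
      refine Fin.cases ?_ (fun i => ?_) j
      · simp [hh]
      · have := hfg i
        rw [Fin.cons_succ, Fin.cons_succ]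
        revert this
        refine Fin.cases ?_ (fun i => ?_) i
        · intro this
          rw [if_pos rfl, Fin.cons_zero] at this
          rw [Fin.cons_zero]
          linear_combination this
        · intro this
          rw [if_neg (Fin.succ_ne_zero i), Fin.cons_succ, add_zero] at this
          rw [Fin.cons_succ, this]

/-- The system is triangular: x g_0 = 0, and x g_{n+1} = y g_n. -/
theorem eq_zero_of_koszul_eq_zero {R : Type*} [CommRing R] [IsDomain R] {x : R} (hx : x ≠ 0) (y : R)
    {ℓ : ℕ} (g : Fin ℓ → R)
    (h : ∀ j, y * Fin.cons (α := fun _ => R) 0 g j - x * Fin.snoc (α := fun _ => R) g 0 j = 0) :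
    ∀ i, g i = 0 := by
  suffices ∀ n (hn : n < ℓ), g ⟨n, hn⟩ = 0 from fun i => this i i.2
  intro n
  induction n with
  | zero =>
    intro hn
    have := h (Fin.castSucc ⟨0, hn⟩)
    rw [Fin.snoc_castSucc] at this
    have h0 : Fin.castSucc ⟨0, hn⟩ = 0 := rfl
    rw [h0, Fin.cons_zero] at this
    simpa [hx] using this
  | succ n ih =>
    intro hn
    have := h (Fin.castSucc ⟨n + 1, hn⟩)
    rw [Fin.snoc_castSucc] at this
    have h0 : Fin.castSucc ⟨n + 1, hn⟩ = Fin.succ ⟨n, by omega⟩ := rfl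
    rw [h0, Fin.cons_succ, ih] at this
    simpa [hx] using this

end Polynomials

/-! ### The short exact sequence 0 → M^(d-1)(-1)^ℓ → B^(ℓ+1) → M^(ℓ) → 0, in shifted copies. -/

section Strand

open MvPolynomial

variable [NeZero d]

/-- Multiplication by a variable, from `M^(d-1)` to `B`. -/
def mulX (k : Type u) [Field k] (d : ℕ) [NeZero d] (s : Fin 2) :
    mcmSubmodule k d (d - 1) →ₗ[CoordRing k d] CoordRing k d where
  toFun q := ⟨X s * (q : MvPolynomial (Fin 2) k), (X_mul_mem_coordSubalgebra_iff s _).2 q.2⟩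
  map_add' p q := Subtype.ext (mul_add (X s) (p : MvPolynomial (Fin 2) k) q)
  map_smul' b q := Subtype.ext (mul_left_comm (X s) (incl k d b) (q : MvPolynomial (Fin 2) k))

theorem incl_mulX (s : Fin 2) (q : mcmSubmodule k d (d - 1)) :
    incl k d (mulX k d s q) = X s * (q : MvPolynomial (Fin 2) k) := rfl

theorem mulX_mem_irrelevant (s : Fin 2) (q : mcmSubmodule k d (d - 1)) :
    mulX k d s q ∈ irrelevant k d := by
  rw [mem_irrelevant_iff, incl_mulX]
  simp

/-- The shift by one comes from 1 + d(n-1) + (d-1) = dn. -/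
theorem mulX_mem_ringPiece (s : Fin 2) {n : ℤ} {q : mcmSubmodule k d (d - 1)}
    (hq : q ∈ (mcmGr k d (d - 1)).piece (n - 1)) : mulX k d s q ∈ ringPiece k d n := by
  have h := mul_mem_forms (X_mem_forms (k := k) s) hq
  have hd : 1 ≤ d := Nat.one_le_iff_ne_zero.2 (NeZero.ne d)
  have e : (1 : ℤ) + (d * (n - 1) + ((d - 1 : ℕ) : ℤ)) = d * n := by
    push_cast [hd]
    ring
  rw [e] at h
  exact h

/-- The generator `x^i y^(ℓ-i)` of `M^(ℓ)`. -/
def mcmGen (k : Type u) [Field k] (d ℓ : ℕ) (i : Fin (ℓ + 1)) : mcmSubmodule k d ℓ :=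
  ⟨X 0 ^ (i : ℕ) * X 1 ^ (ℓ - i), by
    intro m hm
    rw [X_pow_mul_X_pow_eq_monomial] at hm
    have : m = _ := Finset.mem_singleton.1 (support_monomial_subset hm)
    refine ⟨0, ?_⟩
    rw [this, degree_single_add_single]
    omega⟩

theorem mcmGen_mem (ℓ : ℕ) (i : Fin (ℓ + 1)) : mcmGen k d ℓ i ∈ (mcmGr k d ℓ).piece 0 := by
  intro m hm
  change m ∈ (X 0 ^ (i : ℕ) * X 1 ^ (ℓ - i) : MvPolynomial (Fin 2) k).support at hm
  rw [X_pow_mul_X_pow_eq_monomial] at hm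
  have : m = _ := Finset.mem_singleton.1 (support_monomial_subset hm)
  rw [this, degree_single_add_single]
  omega

variable (k d)

/-- The map `B(-D)^(T × (ℓ+1)) → M^(ℓ)(-D)^T` given by the generators `x^i y^(ℓ-i)`. -/
def strandProj (ℓ : ℕ) (T : Type w) [Finite T] (D : ℤ) :
    (freeGr k d (fun _ : T × Fin (ℓ + 1) => D)).carrier →ₗ[CoordRing k d]
      ((mcmGr k d ℓ).copies (fun _ : T => D)).carrier :=
  ((Finsupp.linearEquivFunOnFinite (CoordRing k d) (mcmSubmodule k d ℓ) T).symm.toLinearMap ∘ₗ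
    LinearMap.pi fun t => ∑ i, LinearMap.toSpanSingleton (CoordRing k d) _ (mcmGen k d ℓ i) ∘ₗ
      Finsupp.lapply (t, i) :
    (T × Fin (ℓ + 1) →₀ CoordRing k d) →ₗ[CoordRing k d] (T →₀ mcmSubmodule k d ℓ))

/-- The map `M^(d-1)(-D-1)^(T × ℓ) → B(-D)^(T × (ℓ+1))` with image the kernel of `strandProj`. -/
def strandIncl (ℓ : ℕ) (T : Type w) [Finite T] (D : ℤ) :
    ((mcmGr k d (d - 1)).copies (fun _ : T × Fin ℓ => D + 1)).carrier →ₗ[CoordRing k d]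
      (freeGr k d (fun _ : T × Fin (ℓ + 1) => D)).carrier :=
  ((Finsupp.linearEquivFunOnFinite (CoordRing k d) (CoordRing k d)
      (T × Fin (ℓ + 1))).symm.toLinearMap ∘ₗ
    LinearMap.pi fun p =>
      Fin.cons (α := fun _ => (T × Fin ℓ →₀ mcmSubmodule k d (d - 1)) →ₗ[CoordRing k d] _) 0
        (fun i => mulX k d 1 ∘ₗ Finsupp.lapply (p.1, i)) p.2 -
      Fin.snoc (α := fun _ => (T × Fin ℓ →₀ mcmSubmodule k d (d - 1)) →ₗ[CoordRing k d] _)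
        (fun i => mulX k d 0 ∘ₗ Finsupp.lapply (p.1, i)) 0 p.2 :
    (T × Fin ℓ →₀ mcmSubmodule k d (d - 1)) →ₗ[CoordRing k d]
      (T × Fin (ℓ + 1) →₀ CoordRing k d))

variable {k d}

section

variable (ℓ : ℕ) (T : Type w) [Finite T] (D : ℤ)

theorem strandProj_apply (f : T × Fin (ℓ + 1) →₀ CoordRing k d) (t : T) :
    (show T →₀ mcmSubmodule k d ℓ from strandProj k d ℓ T D f) t =
      ∑ i, f (t, i) • mcmGen k d ℓ i := by
  change (∑ i, LinearMap.toSpanSingleton (CoordRing k d) _ (mcmGen k d ℓ i) ∘ₗ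
      Finsupp.lapply (t, i) : (T × Fin (ℓ + 1) →₀ CoordRing k d) →ₗ[CoordRing k d] _) f = _
  rw [LinearMap.sum_apply]
  rfl

theorem strandProj_apply_coe (f : T × Fin (ℓ + 1) →₀ CoordRing k d) (t : T) :
    (((show T →₀ mcmSubmodule k d ℓ from strandProj k d ℓ T D f) t : mcmSubmodule k d ℓ) :
      MvPolynomial (Fin 2) k) =
      ∑ i, incl k d (f (t, i)) * (X 0 ^ (i : ℕ) * X 1 ^ (ℓ - i)) := by
  rw [strandProj_apply, AddSubmonoidClass.coe_finsetSum]
  rfl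

theorem strandIncl_apply (g : T × Fin ℓ →₀ mcmSubmodule k d (d - 1)) (t : T) (j : Fin (ℓ + 1)) :
    (show T × Fin (ℓ + 1) →₀ CoordRing k d from strandIncl k d ℓ T D g) (t, j) =
      Fin.cons (α := fun _ => CoordRing k d) 0 (fun i => mulX k d 1 (g (t, i))) j -
      Fin.snoc (α := fun _ => CoordRing k d) (fun i => mulX k d 0 (g (t, i))) 0 j := by
  change (Fin.cons (α := fun _ => (T × Fin ℓ →₀ mcmSubmodule k d (d - 1)) →ₗ[CoordRing k d] _) 0
        (fun i => mulX k d 1 ∘ₗ Finsupp.lapply (t, i)) j -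
      Fin.snoc (α := fun _ => (T × Fin ℓ →₀ mcmSubmodule k d (d - 1)) →ₗ[CoordRing k d] _)
        (fun i => mulX k d 0 ∘ₗ Finsupp.lapply (t, i)) 0 j) g = _
  rw [LinearMap.sub_apply]
  congr 1
  · refine Fin.cases ?_ (fun i => ?_) j <;> rfl
  · refine Fin.lastCases ?_ (fun i => ?_) j
    · rw [Fin.snoc_last, Fin.snoc_last]
      rfl
    · rw [Fin.snoc_castSucc, Fin.snoc_castSucc]
      rfl

theorem incl_strandIncl_apply (g : T × Fin ℓ →₀ mcmSubmodule k d (d - 1)) (t : T)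
    (j : Fin (ℓ + 1)) :
    incl k d ((show T × Fin (ℓ + 1) →₀ CoordRing k d from strandIncl k d ℓ T D g) (t, j)) =
      X 1 * Fin.cons (α := fun _ => MvPolynomial (Fin 2) k) 0 (fun i => ↑(g (t, i))) j -
      X 0 * Fin.snoc (α := fun _ => MvPolynomial (Fin 2) k) (fun i => ↑(g (t, i))) 0 j := by
  rw [strandIncl_apply, map_sub]
  congr 1
  · refine Fin.cases ?_ (fun i => ?_) j
    · simp
    · rfl
  · refine Fin.lastCases ?_ (fun i => ?_) j
    · simp [Fin.snoc_last]
    · rw [Fin.snoc_castSucc, Fin.snoc_castSucc]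
      rfl

theorem strandProj_graded : IsGradedHom (strandProj k d ℓ T D) := by
  intro j (f : T × Fin (ℓ + 1) →₀ CoordRing k d) hf t
  change (show T →₀ mcmSubmodule k d ℓ from strandProj k d ℓ T D f) t ∈ _
  rw [strandProj_apply]
  refine Submodule.sum_mem _ fun i _ => ?_
  have := (mcmGr k d ℓ).smul_mem (j - D) 0 (f (t, i)) _ (hf (t, i)) (mcmGen_mem ℓ i)
  rwa [add_zero] at this

theorem strandIncl_graded : IsGradedHom (strandIncl k d ℓ T D) := by
  rintro j (g : T × Fin ℓ →₀ mcmSubmodule k d (d - 1)) hg ⟨t, i⟩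
  change (show T × Fin (ℓ + 1) →₀ CoordRing k d from strandIncl k d ℓ T D g) (t, i) ∈
    ringPiece k d (j - D)
  have hg' : ∀ s i, mulX k d s (g (t, i)) ∈ ringPiece k d (j - D) := by
    intro s i
    refine mulX_mem_ringPiece s ?_
    rw [sub_sub]
    exact hg (t, i)
  rw [strandIncl_apply]
  refine Submodule.sub_mem _ ?_ ?_
  · refine Fin.cases ?_ (fun i => ?_) i
    · exact Submodule.zero_mem _
    · exact hg' 1 i
  · refine Fin.lastCases ?_ (fun i => ?_) i
    · rw [Fin.snoc_last]
      exact Submodule.zero_mem _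
    · rw [Fin.snoc_castSucc]
      exact hg' 0 i

theorem strandProj_surjective : Function.Surjective (strandProj k d ℓ T D) := by
  intro (q : T →₀ mcmSubmodule k d ℓ)
  choose f hf hfq using fun t => exists_sum_mul_monomial (d := d) ℓ (q t).2
  refine ⟨Finsupp.equivFunOnFinite.symm fun p : T × Fin (ℓ + 1) =>
    (⟨f p.1 p.2, hf p.1 p.2⟩ : CoordRing k d), Finsupp.ext fun t => Subtype.ext ?_⟩
  exact (strandProj_apply_coe ℓ T D _ t).trans (hfq t)

theorem strandIncl_injective : Function.Injective (strandIncl k d ℓ T D) := by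
  rw [injective_iff_map_eq_zero]
  intro (g : T × Fin ℓ →₀ mcmSubmodule k d (d - 1)) hg
  refine Finsupp.ext fun ⟨t, i⟩ => Subtype.ext ?_
  refine eq_zero_of_koszul_eq_zero (X_ne_zero (R := k) (0 : Fin 2)) (X 1)
    (fun i => (g (t, i) : MvPolynomial (Fin 2) k)) (fun j => ?_) i
  rw [← incl_strandIncl_apply ℓ T D, hg]
  exact map_zero _

theorem strand_exact : Function.Exact (strandIncl k d ℓ T D) (strandProj k d ℓ T D) := by
  intro (f : T × Fin (ℓ + 1) →₀ CoordRing k d)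
  constructor
  · intro hf
    have hs : ∀ t, ∑ i, incl k d (f (t, i)) * (X 0 ^ (i : ℕ) * X 1 ^ (ℓ - i)) = 0 := by
      intro t
      rw [← strandProj_apply_coe ℓ T D, hf]
      rfl
    choose g hg hfg using fun t => exists_koszul_of_sum_eq_zero (d := d) ℓ
      (fun i => incl k d (f (t, i))) (fun i => (f (t, i)).2) (hs t)
    refine ⟨Finsupp.equivFunOnFinite.symm fun p : T × Fin ℓ =>
      (⟨g p.1 p.2, hg p.1 p.2⟩ : mcmSubmodule k d (d - 1)),
      Finsupp.ext fun ⟨t, j⟩ => Subtype.ext ?_⟩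
    exact (incl_strandIncl_apply ℓ T D _ t j).trans (hfg t j).symm
  · rintro ⟨g, rfl⟩
    refine Finsupp.ext fun t => Subtype.ext ?_
    refine (strandProj_apply_coe ℓ T D _ t).trans ?_
    have h := sum_koszul_eq_zero (X 0 : MvPolynomial (Fin 2) k) (X 1) ℓ
      fun i => ((show T × Fin ℓ →₀ mcmSubmodule k d (d - 1) from g) (t, i) :
        MvPolynomial (Fin 2) k)
    refine Eq.trans (Finset.sum_congr rfl fun j _ => ?_) h
    exact congrArg (· * _) (incl_strandIncl_apply ℓ T D g t j)

/-- The entries are combinations of multiples of x and y, hence have no constant term; this keeps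
the spliced resolution minimal. -/
theorem range_strandIncl_le :
    LinearMap.range (strandIncl k d ℓ T D) ≤ irrelevant k d • ⊤ := by
  rintro _ ⟨g, rfl⟩
  refine (mem_irrelevant_smul_top_iff _).2 fun ⟨t, j⟩ => ?_
  have h := strandIncl_apply ℓ T D g t j
  refine Set.mem_of_eq_of_mem h (sub_mem ?_ ?_)
  · refine Fin.cases ?_ (fun i => ?_) j
    · exact zero_mem _
    · exact mulX_mem_irrelevant _ _
  · refine Fin.lastCases ?_ (fun i => ?_) j
    · rw [Fin.snoc_last]
      exact zero_mem _
    · rw [Fin.snoc_castSucc]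
      exact mulX_mem_irrelevant _ _

end

end Strand

end

/-! ### Splicing a pure resolution with the strands into a minimal free resolution; its ranks. -/

section

open GrMod

variable {k : Type u} [Field k] {d : ℕ}

namespace GrMod

/-- Renaming the index type of a direct sum of copies, all shifted by the same degree. -/
def copiesEquiv (N : GrMod.{u, v} k d) {ι ι' : Type*} (σ : ι ≃ ι') (D : ℤ) :
    (N.copies fun _ : ι => D).carrier ≃ₗ[CoordRing k d] (N.copies fun _ : ι' => D).carrier :=
  (Finsupp.domLCongr σ : (ι →₀ N.carrier) ≃ₗ[CoordRing k d] (ι' →₀ N.carrier))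

theorem copiesEquiv_graded (N : GrMod.{u, v} k d) {ι ι' : Type*} (σ : ι ≃ ι') (D : ℤ) :
    IsGradedHom (N.copiesEquiv σ D).toLinearMap :=
  fun _ _ hf x => hf (σ.symm x)

theorem copiesEquiv_symm_graded (N : GrMod.{u, v} k d) {ι ι' : Type*} (σ : ι ≃ ι') (D : ℤ) :
    IsGradedHom (N.copiesEquiv σ D).symm.toLinearMap :=
  fun _ _ hf x => hf (σ x)

theorem map_mem_irrelevant_smul_top {M : GrMod.{u, v} k d} {N : GrMod.{u, w} k d}
    (f : M.carrier →ₗ[CoordRing k d] N.carrier) {m : M.carrier}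
    (hm : m ∈ (irrelevant k d • ⊤ : Submodule (CoordRing k d) M.carrier)) :
    f m ∈ (irrelevant k d • ⊤ : Submodule (CoordRing k d) N.carrier) := by
  have h := Submodule.mem_map_of_mem (f := f) hm
  rw [Submodule.map_smul''] at h
  exact Submodule.smul_mono le_rfl le_top h

end GrMod

/-- The splicing principle: a surjection in front does not change the image, and an injection behind
does not change the kernel. -/
theorem exact_comp_comp {X Y Y' Z Z' : Type*} [AddCommGroup X] [AddCommGroup Y]
    [AddCommGroup Y'] [AddCommGroup Z] [AddCommGroup Z']
    [Module (CoordRing k d) X] [Module (CoordRing k d) Y] [Module (CoordRing k d) Y']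
    [Module (CoordRing k d) Z] [Module (CoordRing k d) Z']
    {p : X →ₗ[CoordRing k d] Y'} {f : Y' →ₗ[CoordRing k d] Y} {g : Y →ₗ[CoordRing k d] Z}
    {q : Z →ₗ[CoordRing k d] Z'} (hp : Function.Surjective p) (h : Function.Exact f g)
    (hq : Function.Injective q) : Function.Exact (f ∘ₗ p) (q ∘ₗ g) := by
  intro y
  rw [LinearMap.comp_apply, map_eq_zero_iff q hq, h y]
  constructor
  · rintro ⟨z, rfl⟩
    obtain ⟨x, rfl⟩ := hp z
    exact ⟨x, rfl⟩
  · rintro ⟨x, rfl⟩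
    exact ⟨p x, rfl⟩

/-- The superscripts of the modules `M^(·)` that occur as syzygies of `M^(ℓ)`. -/
def strandTwist (d ℓ : ℕ) : ℕ → ℕ
  | 0 => ℓ
  | _ + 1 => d - 1

/-- The index types of the iterated syzygies of a direct sum of copies of `M^(ℓ)`. -/
def strandIndex (d ℓ : ℕ) (T : Type w) : ℕ → Type w
  | 0 => T
  | i + 1 => strandIndex d ℓ T i × Fin (strandTwist d ℓ i)

/-- The degrees of the iterated syzygies of a direct sum of copies of `M^(ℓ)`. -/
def strandDegree (D : ℤ) : ℕ → ℤ
  | 0 => D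
  | i + 1 => strandDegree D i + 1

theorem strandDegree_eq (D : ℤ) (i : ℕ) : strandDegree D i = D + i := by
  induction i with
  | zero => simp [strandDegree]
  | succ i ih =>
    rw [strandDegree, ih]
    push_cast
    ring

instance finite_strandIndex (ℓ : ℕ) (T : Type w) [Finite T] (i : ℕ) :
    Finite (strandIndex d ℓ T i) := by
  induction i with
  | zero => exact ‹Finite T›
  | succ i ih => exact @Finite.instProd _ _ ih _

theorem card_strandIndex_succ (ℓ : ℕ) (T : Type w) (i : ℕ) :
    Nat.card (strandIndex d ℓ T (i + 1)) = Nat.card T * ℓ * (d - 1) ^ i := by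
  induction i with
  | zero =>
    change Nat.card (T × Fin ℓ) = _
    rw [Nat.card_prod, Nat.card_fin, pow_zero, mul_one]
  | succ i ih =>
    change Nat.card (strandIndex d ℓ T (i + 1) × Fin (d - 1)) = _
    rw [Nat.card_prod, Nat.card_fin, ih, pow_succ, mul_assoc]

variable [NeZero d]

/-- The data of a pure resolution, with arbitrary index types for the copies. -/
structure PureResolution (M : GrMod.{u, v} k d) (d₀ d₁ d₂ : ℤ) (ℓ : ℕ) (A B R : Type w) where
  ε : (freeGr k d (fun _ : A => d₀)).carrier →ₗ[CoordRing k d] M.carrier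
  φ : (freeGr k d (fun _ : B => d₁)).carrier →ₗ[CoordRing k d]
    (freeGr k d (fun _ : A => d₀)).carrier
  ψ : ((mcmGr k d ℓ).copies (fun _ : R => d₂)).carrier →ₗ[CoordRing k d]
    (freeGr k d (fun _ : B => d₁)).carrier
  ε_graded : IsGradedHom ε
  φ_graded : IsGradedHom φ
  ψ_graded : IsGradedHom ψ
  ε_surjective : Function.Surjective ε
  exact_φ_ε : Function.Exact φ ε
  exact_ψ_φ : Function.Exact ψ φ
  ψ_injective : Function.Injective ψ
  range_φ_le : LinearMap.range φ ≤ irrelevant k d • ⊤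
  range_ψ_le : LinearMap.range ψ ≤ irrelevant k d • ⊤

namespace PureResolution

universe w'

variable {M : GrMod.{u, v} k d} {d₀ d₁ d₂ : ℤ} {ℓ : ℕ} {A B R : Type w} {A' B' R' : Type w'}

/-- Renaming the index types of a pure resolution. -/
def reindex (Q : PureResolution M d₀ d₁ d₂ ℓ A B R) (α : A ≃ A') (β : B ≃ B') (ρ : R ≃ R') :
    PureResolution M d₀ d₁ d₂ ℓ A' B' R' where
  ε := Q.ε ∘ₗ ((ringGr k d).copiesEquiv α d₀).symm.toLinearMap
  φ := ((ringGr k d).copiesEquiv α d₀).toLinearMap ∘ₗ Q.φ ∘ₗ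
    ((ringGr k d).copiesEquiv β d₁).symm.toLinearMap
  ψ := ((ringGr k d).copiesEquiv β d₁).toLinearMap ∘ₗ Q.ψ ∘ₗ
    ((mcmGr k d ℓ).copiesEquiv ρ d₂).symm.toLinearMap
  ε_graded := Q.ε_graded.comp (copiesEquiv_symm_graded _ _ _)
  φ_graded := (copiesEquiv_graded _ _ _).comp (Q.φ_graded.comp (copiesEquiv_symm_graded _ _ _))
  ψ_graded := (copiesEquiv_graded _ _ _).comp (Q.ψ_graded.comp (copiesEquiv_symm_graded _ _ _))
  ε_surjective := Q.ε_surjective.comp (LinearEquiv.surjective _)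
  exact_φ_ε := by
    intro y
    constructor
    · intro hy
      obtain ⟨z, hz⟩ := (Q.exact_φ_ε _).1 hy
      refine ⟨(ringGr k d).copiesEquiv β d₁ z, ?_⟩
      simp [hz]
    · rintro ⟨z, rfl⟩
      simpa using (Q.exact_φ_ε _).2 ⟨((ringGr k d).copiesEquiv β d₁).symm z, rfl⟩
  exact_ψ_φ := by
    intro y
    constructor
    · intro hy
      obtain ⟨z, hz⟩ := (Q.exact_ψ_φ _).1 (((ringGr k d).copiesEquiv α d₀).map_eq_zero_iff.1 hy)
      refine ⟨(mcmGr k d ℓ).copiesEquiv ρ d₂ z, ?_⟩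
      simp [hz]
    · rintro ⟨z, rfl⟩
      simpa using (Q.exact_ψ_φ _).2 ⟨((mcmGr k d ℓ).copiesEquiv ρ d₂).symm z, rfl⟩
  ψ_injective := ((ringGr k d).copiesEquiv β d₁).injective.comp
    (Q.ψ_injective.comp ((mcmGr k d ℓ).copiesEquiv ρ d₂).symm.injective)
  range_φ_le := by
    rintro _ ⟨z, rfl⟩
    exact map_mem_irrelevant_smul_top ((ringGr k d).copiesEquiv α d₀).toLinearMap
      (Q.range_φ_le ⟨_, rfl⟩)
  range_ψ_le := by
    rintro _ ⟨z, rfl⟩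
    exact map_mem_irrelevant_smul_top ((ringGr k d).copiesEquiv β d₁).toLinearMap
      (Q.range_ψ_le ⟨_, rfl⟩)

end PureResolution

theorem GrMod.HasPureResolution.exists_pureResolution {M : GrMod.{u, v} k d} {d₀ d₁ d₂ : ℤ} {ℓ : ℕ}
    (h : M.HasPureResolution d₀ d₁ d₂ ℓ) :
    ∃ a b r : ℕ, Nonempty (PureResolution M d₀ d₁ d₂ ℓ (Fin a) (Fin b) (Fin r)) := by
  obtain ⟨a, b, r, ε, φ, ψ, h1, h2, h3, h4, h5, h6, h7, h8, h9⟩ := h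
  exact ⟨a, b, r, ⟨⟨ε, φ, ψ, h1, h2, h3, h4, h5, h6, h7, h8, h9⟩⟩⟩

namespace PureResolution

variable {M : GrMod.{u, v} k d} {d₀ d₁ d₂ : ℤ} {ℓ : ℕ} {A B R : Type (max u v)}

/-- The index types of the minimal free resolution obtained from a pure resolution. -/
def resIndex (d ℓ : ℕ) (A B R : Type w) : ℕ → Type w
  | 0 => A
  | 1 => B
  | i + 2 => strandIndex d ℓ R i × Fin (strandTwist d ℓ i + 1)

/-- The degrees of the generators of the minimal free resolution. -/
def resDegree (d₀ d₁ d₂ : ℤ) : ℕ → ℤ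
  | 0 => d₀
  | 1 => d₁
  | i + 2 => strandDegree d₂ i

instance finite_resIndex (d : ℕ) [NeZero d] (ℓ : ℕ) (A B R : Type w) [Finite A] [Finite B]
    [Finite R] : ∀ i, Finite (resIndex d ℓ A B R i)
  | 0 => ‹Finite A›
  | 1 => ‹Finite B›
  | i + 2 => inferInstanceAs (Finite (strandIndex d ℓ R i × Fin (strandTwist d ℓ i + 1)))

/-- The differentials of the minimal free resolution. -/
def resDiff [Finite R] (Q : PureResolution M d₀ d₁ d₂ ℓ A B R) : ∀ i,
    (freeGr k d (fun _ : resIndex d ℓ A B R (i + 1) => resDegree d₀ d₁ d₂ (i + 1))).carrier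
      →ₗ[CoordRing k d]
    (freeGr k d (fun _ : resIndex d ℓ A B R i => resDegree d₀ d₁ d₂ i)).carrier
  | 0 => Q.φ
  | 1 => Q.ψ ∘ₗ strandProj k d ℓ R d₂
  | i + 2 =>
    strandIncl k d (strandTwist d ℓ i) (strandIndex d ℓ R i) (strandDegree d₂ i) ∘ₗ
      strandProj k d (d - 1) (strandIndex d ℓ R (i + 1)) (strandDegree d₂ (i + 1))

/-- The minimal graded free resolution obtained from a pure resolution by resolving the module
`M^(ℓ)(-d₂)^R`. -/
def toGradedFreeResolution [Finite R] (Q : PureResolution M d₀ d₁ d₂ ℓ A B R) :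
    GradedFreeResolution M where
  ι := resIndex d ℓ A B R
  deg i _ := resDegree d₀ d₁ d₂ i
  diff := Q.resDiff
  aug := Q.ε
  diff_graded
    | 0 => Q.φ_graded
    | 1 => Q.ψ_graded.comp (strandProj_graded ℓ R d₂)
    | _ + 2 => (strandIncl_graded _ _ _).comp (strandProj_graded _ _ _)
  aug_graded := Q.ε_graded
  aug_surjective := Q.ε_surjective
  exact_zero := Q.exact_φ_ε
  exact_succ
    -- The strands begin only at the second differential, so φ needs no injection after it.
    | 0 => exact_comp_comp (q := LinearMap.id) (strandProj_surjective ℓ R d₂) Q.exact_ψ_φ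
        Function.injective_id
    | 1 => exact_comp_comp (strandProj_surjective _ _ _) (strand_exact ℓ R d₂) Q.ψ_injective
    | _ + 2 => exact_comp_comp (strandProj_surjective _ _ _) (strand_exact _ _ _)
        (strandIncl_injective _ _ _)

theorem range_toGradedFreeResolution_le [Finite R] (Q : PureResolution M d₀ d₁ d₂ ℓ A B R) :
    ∀ i, LinearMap.range (Q.toGradedFreeResolution.diff i) ≤ irrelevant k d • ⊤
  | 0 => Q.range_φ_le
  | 1 => (LinearMap.range_comp_le_range _ _).trans Q.range_ψ_le
  | _ + 2 => (LinearMap.range_comp_le_range _ _).trans (range_strandIncl_le _ _ _)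

variable [Finite A] [Finite B] [Finite R] (Q : PureResolution M d₀ d₁ d₂ ℓ A B R)

instance finite_index (i : ℕ) : Finite (Q.toGradedFreeResolution.ι i) :=
  finite_resIndex d ℓ A B R i

end PureResolution

namespace PureResolution

variable {M : GrMod.{u, v} k d} {d₀ d₁ d₂ : ℤ} {ℓ a b r : ℕ}

/-- The index types of a pure resolution, moved to the universe of graded free resolutions. -/
abbrev lift
    (Q : PureResolution M d₀ d₁ d₂ ℓ (Fin a) (Fin b) (Fin r)) : PureResolution M d₀ d₁ d₂ ℓ (ULift.{max u v} (Fin a)) (ULift.{max u v} (Fin b))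
    (ULift.{max u v} (Fin r)) :=
  Q.reindex Equiv.ulift.symm Equiv.ulift.symm Equiv.ulift.symm

theorem finite_tor
    (Q : PureResolution M d₀ d₁ d₂ ℓ (Fin a) (Fin b) (Fin r)) (i : ℕ) (j : ℤ) : Module.Finite k (M.Tor i j) :=
  Q.lift.toGradedFreeResolution.finite_tor_of_minimal Q.lift.range_toGradedFreeResolution_le
    (D := resDegree d₀ d₁ d₂) (fun _ _ => rfl) i j

theorem gradedBetti_eq_zero
    (Q : PureResolution M d₀ d₁ d₂ ℓ (Fin a) (Fin b) (Fin r)) (i : ℕ) {j : ℤ} (hj : j ≠ resDegree d₀ d₁ d₂ i) :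
    M.gradedBetti i j = 0 := by
  rw [Q.lift.toGradedFreeResolution.gradedBetti_of_minimal Q.lift.range_toGradedFreeResolution_le
    (D := resDegree d₀ d₁ d₂) (fun _ _ => rfl) i j, if_neg hj]

theorem betti_eq
    (Q : PureResolution M d₀ d₁ d₂ ℓ (Fin a) (Fin b) (Fin r)) (i : ℕ) : M.betti i = Nat.card (resIndex d ℓ (ULift.{max u v} (Fin a))
    (ULift.{max u v} (Fin b)) (ULift.{max u v} (Fin r)) i) :=
  Q.lift.toGradedFreeResolution.betti_of_minimal Q.lift.range_toGradedFreeResolution_le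
    (D := resDegree d₀ d₁ d₂) (fun _ _ => rfl) i

theorem betti_zero
    (Q : PureResolution M d₀ d₁ d₂ ℓ (Fin a) (Fin b) (Fin r)) : M.betti 0 = a := by
  rw [Q.betti_eq]
  exact (Nat.card_congr Equiv.ulift).trans (Nat.card_fin a)

theorem betti_one
    (Q : PureResolution M d₀ d₁ d₂ ℓ (Fin a) (Fin b) (Fin r)) : M.betti 1 = b := by
  rw [Q.betti_eq]
  exact (Nat.card_congr Equiv.ulift).trans (Nat.card_fin b)

theorem betti_two
    (Q : PureResolution M d₀ d₁ d₂ ℓ (Fin a) (Fin b) (Fin r)) : M.betti 2 = r * (ℓ + 1) := by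
  rw [Q.betti_eq]
  change Nat.card (ULift.{max u v} (Fin r) × Fin (ℓ + 1)) = _
  rw [Nat.card_prod, Nat.card_congr Equiv.ulift, Nat.card_fin, Nat.card_fin]

/-- The first syzygy contributes the factor ℓ, each of the i later ones d - 1, and the generators of
the final M^(d-1) contribute d. -/
theorem betti_add_three
    (Q : PureResolution M d₀ d₁ d₂ ℓ (Fin a) (Fin b) (Fin r)) (i : ℕ) : M.betti (i + 3) = r * ℓ * (d - 1) ^ i * d := by
  rw [Q.betti_eq]
  change Nat.card (strandIndex d ℓ (ULift.{max u v} (Fin r)) (i + 1) × Fin (d - 1 + 1)) = _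
  rw [Nat.card_prod, card_strandIndex_succ, Nat.card_congr Equiv.ulift, Nat.card_fin, Nat.card_fin,
    Nat.sub_add_cancel (Nat.one_le_iff_ne_zero.2 (NeZero.ne d))]

end PureResolution

end

/-! ### Hilbert functions of B and M^(ℓ), and vanishing of finite-length modules in large degree. -/

section

open GrMod

variable {k : Type u} [Field k] {d : ℕ}

section HilbertFunction

theorem forms_eq_restrictSupport (n : ℕ) :
    forms k n = MvPolynomial.restrictSupport k
      (↑((Finset.univ : Finset (Fin 2)).finsuppAntidiag n) : Set (Fin 2 →₀ ℕ)) := by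
  ext p
  rw [MvPolynomial.mem_restrictSupport_iff]
  refine forall₂_congr fun m _ => ?_
  rw [Finset.mem_coe, Finset.mem_finsuppAntidiag, Nat.cast_inj, Finsupp.degree_eq_sum]
  simp only [Finset.subset_univ, and_true]

theorem finite_forms (n : ℕ) : Module.Finite k (forms k n) := by
  rw [forms_eq_restrictSupport]
  exact Module.Finite.of_basis (MvPolynomial.basisRestrictSupport k _)

theorem finrank_forms (n : ℕ) : Module.finrank k (forms k n) = n + 1 := by
  rw [forms_eq_restrictSupport,
    Module.finrank_eq_nat_card_basis (MvPolynomial.basisRestrictSupport k _)]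
  rw [Nat.card_coe_set_eq, Set.ncard_coe_finset, Finset.card_finsuppAntidiag_nat_eq_choose,
    Finset.card_univ, Fintype.card_fin, show 2 + n - 1 = n + 1 by omega, Nat.choose_succ_self_right]

/-- A subspace contained in the range of an injective map is isomorphic to its preimage. -/
def comapEquivOfInjective {V W : Type*} [AddCommGroup V] [Module k V] [AddCommGroup W] [Module k W]
    (i : V →ₗ[k] W) (hi : Function.Injective i) (p : Submodule k W) (hp : p ≤ LinearMap.range i) :
    p.comap i ≃ₗ[k] p :=
  (Submodule.equivMapOfInjective i hi (p.comap i)).trans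
    (LinearEquiv.ofEq _ _ (Submodule.map_comap_eq_self hp))

namespace GrMod

variable (N : GrMod.{u, v} k d) {ι : Type w}

/-- The pieces of a finite direct sum of shifted copies of `N`. -/
def copiesPieceEquiv [Finite ι] (D n : ℤ) :
    (N.copies fun _ : ι => D).piece n ≃ₗ[k] (ι → N.piece (n - D)) where
  toFun f x := ⟨(show ι →₀ N.carrier from f.1) x, f.2 x⟩
  map_add' _ _ := rfl
  map_smul' _ _ := rfl
  invFun g := ⟨(Finsupp.equivFunOnFinite.symm fun x => (g x : N.carrier) : ι →₀ N.carrier),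
    fun x => (g x).2⟩
  left_inv _ := Subtype.ext (Finsupp.ext fun _ => rfl)
  right_inv _ := rfl

theorem finite_copies_piece [Finite ι] (D n : ℤ) [Module.Finite k (N.piece (n - D))] :
    Module.Finite k ((N.copies fun _ : ι => D).piece n) :=
  Module.Finite.equiv (N.copiesPieceEquiv D n).symm

theorem finrank_copies_piece [Fintype ι] (D n : ℤ) [Module.Finite k (N.piece (n - D))] :
    Module.finrank k ((N.copies fun _ : ι => D).piece n) =
      Fintype.card ι * Module.finrank k (N.piece (n - D)) := by
  rw [(N.copiesPieceEquiv D n).finrank_eq, Module.finrank_pi_fintype, Finset.sum_const,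
    Finset.card_univ, smul_eq_mul]

end GrMod

/-- In degree at most 0 there are only constants, and 𝔪 contains no nonzero constant. -/
theorem eq_zero_of_mem_ringPiece_of_mem_irrelevant {n : ℤ} (hn : n ≤ 0) {b : CoordRing k d}
    (hb : b ∈ ringPiece k d n) (hb' : b ∈ irrelevant k d) : b = 0 := by
  refine Subtype.ext (MvPolynomial.support_eq_empty.1 (Finset.eq_empty_of_forall_notMem ?_))
  intro m hm
  have h1 : (m.degree : ℤ) = d * n := hb m hm
  have h2 : (d : ℤ) * n ≤ 0 := mul_nonpos_of_nonneg_of_nonpos (Int.natCast_nonneg d) hn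
  have h3 : m = 0 := m.degree_eq_zero_iff.1 (by omega)
  subst h3
  exact MvPolynomial.mem_support_iff.1 hm hb'

variable [NeZero d]

/-- The degree `n ≥ 0` part of `M^(ℓ)` is `S_{nd+ℓ}`. -/
def mcmPieceEquiv (k : Type u) [Field k] (d : ℕ) [NeZero d] (ℓ n : ℕ) :
    (mcmGr k d ℓ).piece n ≃ₗ[k] forms k ((d * n + ℓ : ℕ) : ℤ) :=
  (LinearEquiv.ofEq _ _ (by
    have e : (d : ℤ) * n + ℓ = ((d * n + ℓ : ℕ) : ℤ) := by push_cast; rfl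
    rw [← e]
    rfl)).trans
  (comapEquivOfInjective ((mcmSubmodule k d ℓ).subtype.restrictScalars k) Subtype.val_injective
    (forms k ((d * n + ℓ : ℕ) : ℤ)) fun p hp =>
      ⟨⟨p, fun m hm => ⟨n, by rw [mul_comm n]; exact_mod_cast hp m hm⟩⟩, rfl⟩)

/-- The degree `n ≥ 0` part of `B` is `S_{nd}`. -/
def ringPieceEquiv (k : Type u) [Field k] (d : ℕ) [NeZero d] (n : ℕ) :
    (ringGr k d).piece n ≃ₗ[k] forms k ((d * n : ℕ) : ℤ) :=
  (LinearEquiv.ofEq _ _ (by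
    have e : (d : ℤ) * n = ((d * n : ℕ) : ℤ) := by push_cast; rfl
    rw [← e]
    rfl)).trans
  (comapEquivOfInjective (incl k d).toLinearMap Subtype.val_injective
    (forms k ((d * n : ℕ) : ℤ)) fun p hp =>
      ⟨⟨p, fun m hm => ⟨n, by rw [mul_comm n]; exact_mod_cast hp m hm⟩⟩, rfl⟩)

theorem finite_mcmGr_piece (ℓ n : ℕ) : Module.Finite k ((mcmGr k d ℓ).piece n) :=
  have := finite_forms (k := k) (d * n + ℓ)
  Module.Finite.equiv (mcmPieceEquiv k d ℓ n).symm

theorem finrank_mcmGr_piece (ℓ n : ℕ) :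
    Module.finrank k ((mcmGr k d ℓ).piece n) = d * n + ℓ + 1 := by
  rw [(mcmPieceEquiv k d ℓ n).finrank_eq, finrank_forms]

theorem finite_ringGr_piece (n : ℕ) : Module.Finite k ((ringGr k d).piece n) :=
  have := finite_forms (k := k) (d * n)
  Module.Finite.equiv (ringPieceEquiv k d n).symm

theorem finrank_ringGr_piece (n : ℕ) : Module.finrank k ((ringGr k d).piece n) = d * n + 1 := by
  rw [(ringPieceEquiv k d n).finrank_eq, finrank_forms]

theorem ringPiece_eq_bot {n : ℤ} (hn : n < 0) : ringPiece k d n = ⊥ := by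
  rw [eq_bot_iff]
  intro b hb
  refine Subtype.ext (MvPolynomial.support_eq_empty.1 (Finset.eq_empty_of_forall_notMem ?_))
  intro m hm
  have h1 : (m.degree : ℤ) = d * n := hb m hm
  have h2 : (d : ℤ) * n < 0 :=
    mul_neg_of_pos_of_neg (by exact_mod_cast Nat.pos_of_ne_zero (NeZero.ne d)) hn
  omega

namespace GrMod

/-- The truncation `M_{≥ n}` of a graded module. -/
def truncation (M : GrMod.{u, v} k d) (n : ℤ) : Submodule (CoordRing k d) M.carrier where
  carrier := {m | ∀ j < n, M.proj j m = 0}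
  zero_mem' j _ := map_zero _
  add_mem' ha hb j hj := by rw [map_add, ha j hj, hb j hj, add_zero]
  smul_mem' := by
    intro b m hm j hj
    obtain ⟨s, hs⟩ := (ringGr k d).exists_sum_proj b
    obtain ⟨t, ht⟩ := M.exists_sum_proj m
    rw [ht, Finset.smul_sum, map_sum]
    refine Finset.sum_eq_zero fun i _ => ?_
    by_cases hi : i < n
    · rw [hm i hi, smul_zero, map_zero]
    · have hb : b • M.proj i m =
          ∑ j ∈ s, (show CoordRing k d from (ringGr k d).proj j b) • M.proj i m := by
        rw [← Finset.sum_smul]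
        exact congrArg (· • M.proj i m) hs
      rw [hb, map_sum]
      refine Finset.sum_eq_zero fun l _ => ?_
      have hl : (ringGr k d).proj l b ∈ ringPiece k d l := (ringGr k d).proj_mem l b
      -- B has nothing in negative degrees, so multiplication cannot bring an element of degree at
      -- least n below n.
      by_cases hl0 : l < 0
      · rw [ringPiece_eq_bot hl0] at hl
        have h0 : (show CoordRing k d from (ringGr k d).proj l b) = 0 := hl
        rw [h0, zero_smul, map_zero]
      · exact M.proj_of_mem_ne (M.smul_mem l i _ _ hl (M.proj_mem i m)) (by omega)

/-- The truncations form a descending chain of submodules. Where two consecutive ones agree, the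
piece between them is zero. -/
theorem exists_piece_eq_bot (M : GrMod.{u, v} k d) [IsArtinian (CoordRing k d) M.carrier] :
    ∃ n₀ : ℕ, ∀ n : ℕ, n₀ ≤ n → M.piece n = ⊥ := by
  obtain ⟨n₀, h⟩ := IsArtinian.monotone_stabilizes (R := CoordRing k d) (M := M.carrier)
    ⟨fun n : ℕ => OrderDual.toDual (M.truncation n), fun a b hab m hm j hj =>
      hm j (hj.trans_le (by exact_mod_cast hab))⟩
  refine ⟨n₀, fun n hn => ?_⟩
  have h1 : M.truncation n = M.truncation (n + 1 : ℕ) :=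
    (h n hn).symm.trans (h (n + 1) (hn.trans (Nat.le_succ n)))
  rw [eq_bot_iff]
  intro m hm
  have h2 : m ∈ M.truncation n := fun j hj => M.proj_of_mem_ne hm hj.ne'
  rw [h1] at h2
  have h3 := h2 n (by push_cast; omega)
  rwa [M.proj_of_mem hm] at h3

end GrMod

end HilbertFunction

/-! ### Herzog–Kühl equations for the ranks of a pure resolution. -/

namespace PureResolution

variable [NeZero d] {M : GrMod.{u, v} k d} {d₀ d₁ d₂ : ℤ} {ℓ : ℕ}

/-- Where M_n = 0, the degree n strand is a short exact sequence of vector spaces. Preimages are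
made homogeneous by projecting to degree n. -/
theorem finrank_piece_eq_add {A B R : Type w} (Q : PureResolution M d₀ d₁ d₂ ℓ A B R) {n : ℤ}
    (hn : M.piece n = ⊥)
    [Module.Finite k ((freeGr k d (fun _ : B => d₁)).piece n)] :
    Module.finrank k ((freeGr k d (fun _ : B => d₁)).piece n) =
      Module.finrank k ((freeGr k d (fun _ : A => d₀)).piece n) +
        Module.finrank k (((mcmGr k d ℓ).copies (fun _ : R => d₂)).piece n) := by
  let f := (Q.φ.restrictScalars k).restrict (Q.φ_graded n)
  let g := (Q.ψ.restrictScalars k).restrict (Q.ψ_graded n)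
  have hf : LinearMap.range f = ⊤ := by
    rw [LinearMap.range_eq_top]
    rintro ⟨y, hy⟩
    have h0 : Q.ε y = 0 := by
      have := Q.ε_graded n y hy
      rwa [hn, Submodule.mem_bot] at this
    obtain ⟨z, hz⟩ := (Q.exact_φ_ε y).1 h0
    refine ⟨⟨_, GrMod.proj_mem _ n z⟩, Subtype.ext ?_⟩
    refine (proj_apply_of_isGradedHom Q.φ_graded n z).symm.trans ?_
    rw [hz, GrMod.proj_of_mem _ hy]
  have hg : LinearMap.ker f = LinearMap.range g := by
    ext ⟨y, hy⟩
    rw [LinearMap.mem_ker, LinearMap.mem_range]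
    constructor
    · intro h
      obtain ⟨z, hz⟩ := (Q.exact_ψ_φ y).1 (congrArg Subtype.val h)
      refine ⟨⟨_, GrMod.proj_mem _ n z⟩, Subtype.ext ?_⟩
      refine (proj_apply_of_isGradedHom Q.ψ_graded n z).symm.trans ?_
      rw [hz, GrMod.proj_of_mem _ hy]
    · rintro ⟨z, hz⟩
      exact Subtype.ext ((Q.exact_ψ_φ y).2 ⟨z.1, congrArg Subtype.val hz⟩)
  have hinj : Function.Injective g := fun x y h =>
    Subtype.ext (Q.ψ_injective (congrArg Subtype.val h))
  rw [← LinearMap.finrank_range_add_finrank_ker f, hf, finrank_top, hg,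
    LinearMap.finrank_range_of_inj hinj]

variable {a b r : ℕ}

/-- Comparison of the Hilbert functions of the terms of a pure resolution in large degrees. -/
theorem hilbert_equations (hM : IsFiniteLength (CoordRing k d) M.carrier)
    (Q : PureResolution M d₀ d₁ d₂ ℓ (Fin a) (Fin b) (Fin r)) :
    b = a + r ∧ (a : ℤ) * (d * (d₁ - d₀)) = r * (d * (d₂ - d₁) - ℓ) := by
  have := (isFiniteLength_iff_isNoetherian_isArtinian.1 hM).2
  obtain ⟨n₀, hn₀⟩ := M.exists_piece_eq_bot
  have key : ∀ n : ℕ, n₀ ≤ n → d₀ ≤ n → d₁ ≤ n → d₂ ≤ n →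
      (b : ℤ) * (d * (n - d₁) + 1) =
        a * (d * (n - d₀) + 1) + r * (d * (n - d₂) + ℓ + 1) := by
    intro n hn h0 h1 h2
    obtain ⟨m₀, hm₀⟩ := Int.eq_ofNat_of_zero_le (sub_nonneg.2 h0)
    obtain ⟨m₁, hm₁⟩ := Int.eq_ofNat_of_zero_le (sub_nonneg.2 h1)
    obtain ⟨m₂, hm₂⟩ := Int.eq_ofNat_of_zero_le (sub_nonneg.2 h2)
    have i0 : Module.Finite k ((ringGr k d).piece (n - d₀)) := hm₀ ▸ finite_ringGr_piece m₀
    have i1 : Module.Finite k ((ringGr k d).piece (n - d₁)) := hm₁ ▸ finite_ringGr_piece m₁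
    have i2 : Module.Finite k ((mcmGr k d ℓ).piece (n - d₂)) := hm₂ ▸ finite_mcmGr_piece ℓ m₂
    have := (ringGr k d).finite_copies_piece (ι := Fin b) d₁ n
    have h := Q.finrank_piece_eq_add (hn₀ n hn)
    rw [GrMod.finrank_copies_piece, GrMod.finrank_copies_piece, GrMod.finrank_copies_piece,
      Fintype.card_fin, Fintype.card_fin, Fintype.card_fin, hm₀, hm₁, hm₂, finrank_ringGr_piece,
      finrank_ringGr_piece, finrank_mcmGr_piece] at h
    rw [hm₀, hm₁, hm₂]
    exact_mod_cast h
  obtain ⟨n, hn⟩ : ∃ n : ℕ, n₀ ≤ n ∧ d₀ ≤ n ∧ d₁ ≤ n ∧ d₂ ≤ n :=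
    ⟨n₀ + d₀.toNat + d₁.toNat + d₂.toNat, by omega⟩
  have e1 := key n hn.1 hn.2.1 hn.2.2.1 hn.2.2.2
  -- Both sides are affine in n. Two consecutive values give the slope, d·b = d·(a + r);
  -- substituting back gives the constant term.
  have e2 := key (n + 1) (by omega) (by omega) (by omega) (by omega)
  push_cast at e2
  have hd : (d : ℤ) ≠ 0 := by exact_mod_cast NeZero.ne d
  have e3 : (b : ℤ) = a + r := mul_left_cancel₀ hd (by linear_combination e2 - e1)
  refine ⟨by exact_mod_cast e3, ?_⟩
  rw [e3] at e1
  linear_combination -e1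

/-- If φ = 0 then ψ is onto F₁, so by minimality a basis vector would lie in 𝔪F₁, putting 1 in 𝔪. -/
theorem eq_zero_of_phi_eq_zero (Q : PureResolution M d₀ d₁ d₂ ℓ (Fin a) (Fin b) (Fin r))
    (h : Q.φ = 0) : b = 0 := by
  by_contra hb
  let x : Fin b := ⟨0, Nat.pos_of_ne_zero hb⟩
  obtain ⟨z, hz⟩ := (Q.exact_ψ_φ (freeBasis k d _ x)).1 (by rw [h]; rfl)
  have h1 : freeBasis k d (fun _ : Fin b => d₁) x ∈ irrelevant k d • ⊤ := Q.range_ψ_le ⟨z, hz⟩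
  have h2 := (mem_irrelevant_smul_top_iff (e := fun _ : Fin b => d₁)
    (Finsupp.single x (1 : CoordRing k d))).1 h1 x
  rw [Finsupp.single_eq_same] at h2
  refine one_ne_zero (α := k) ((algebraMap_mem_irrelevant_iff (d := d) (1 : k)).1 ?_)
  rwa [map_one]

/-- The matrix entries of φ have degree d₁ - d₀ and lie in 𝔪, so they vanish unless that degree is
positive. -/
theorem degree_lt_of_phi_ne_zero (Q : PureResolution M d₀ d₁ d₂ ℓ (Fin a) (Fin b) (Fin r))
    (h : Q.φ ≠ 0) : d₀ < d₁ := by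
  by_contra hlt
  refine h (free_hom_ext fun x => ?_)
  refine Finsupp.ext fun y => ?_
  exact eq_zero_of_mem_ringPiece_of_mem_irrelevant (n := d₁ - d₀) (by omega)
    (Q.φ_graded _ _ (freeBasis_mem x) y)
    ((mem_irrelevant_smul_top_iff _).1 (Q.range_φ_le ⟨_, rfl⟩) y)

theorem subsingleton_of_eq_zero (Q : PureResolution M d₀ d₁ d₂ ℓ (Fin 0) (Fin b) (Fin r)) :
    Subsingleton M.carrier :=
  have : Subsingleton (freeGr k d (fun _ : Fin 0 => d₀)).carrier :=
    inferInstanceAs (Subsingleton (Fin 0 →₀ CoordRing k d))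
  Q.ε_surjective.subsingleton

/-- The Herzog–Kühl type equations for the ranks in a pure resolution. -/
theorem exists_rank_eq (hM : IsFiniteLength (CoordRing k d) M.carrier)
    (Q : PureResolution M d₀ d₁ d₂ ℓ (Fin a) (Fin b) (Fin r)) :
    ∃ c : ℚ, (Nontrivial M.carrier → 0 < c) ∧
      (a : ℚ) = c * ((d : ℚ) * ((d₂ : ℚ) - (d₁ : ℚ)) - (ℓ : ℚ)) ∧
      (b : ℚ) = c * ((d : ℚ) * ((d₂ : ℚ) - (d₀ : ℚ)) - (ℓ : ℚ)) ∧
      (r : ℚ) = c * ((d : ℚ) * ((d₁ : ℚ) - (d₀ : ℚ))) := by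
  obtain ⟨hb, he⟩ := Q.hilbert_equations hM
  rcases Nat.eq_zero_or_pos a with rfl | ha
  · have hs := Q.subsingleton_of_eq_zero
    have hb0 : b = 0 := Q.eq_zero_of_phi_eq_zero (LinearMap.ext fun z =>
      Finsupp.ext fun x : Fin 0 => x.elim0)
    have hr0 : r = 0 := by omega
    -- With a = 0 everything vanishes, and d₁ - d₀ may be zero, so c = 0 is chosen directly.
    refine ⟨0, fun h => absurd hs (not_subsingleton_iff_nontrivial.2 h), ?_, ?_, ?_⟩ <;>
      simp [hb0, hr0]
  · have hφ : Q.φ ≠ 0 := fun h => by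
      have := Q.eq_zero_of_phi_eq_zero h
      omega
    have hlt := Q.degree_lt_of_phi_ne_zero hφ
    have hd : (0 : ℚ) < d := by exact_mod_cast Nat.pos_of_ne_zero (NeZero.ne d)
    have hlt' : (0 : ℚ) < d₁ - d₀ := sub_pos.2 (by exact_mod_cast hlt)
    have he' : (a : ℚ) * (d * (d₁ - d₀)) = r * (d * (d₂ - d₁) - ℓ) := by exact_mod_cast he
    have hb' : (b : ℚ) = a + r := by exact_mod_cast hb
    -- Otherwise the equation reads a·d(d₁ - d₀) = 0, although all factors are positive.
    have hr : r ≠ 0 := by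
      rintro rfl
      have ha' : (0 : ℚ) < a := by exact_mod_cast ha
      have : 0 < (a : ℚ) * (d * (d₁ - d₀)) := by positivity
      rw [he'] at this
      simp at this
    have hr' : (0 : ℚ) < r := by exact_mod_cast Nat.pos_of_ne_zero hr
    have hne : (d : ℚ) * (d₁ - d₀) ≠ 0 := by positivity
    -- The scalar is forced by the equation for r; the other two follow from the Hilbert function
    -- identities.
    refine ⟨r / (d * (d₁ - d₀)), fun _ => by positivity, ?_, ?_, ?_⟩
    · rw [div_mul_eq_mul_div, eq_div_iff hne, he']
    · rw [div_mul_eq_mul_div, eq_div_iff hne, hb']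
      linear_combination he'
    · rw [div_mul_cancel₀ _ hne]

end PureResolution

end

end RatNormal

end

theorem proposition3p2 {k : Type u} [Field k] (d : ℕ) [NeZero d]
    (M : RatNormal.GrMod.{u, v} k d)
    (hM : IsFiniteLength (RatNormal.CoordRing k d) M.carrier)
    (d₀ d₁ d₂ : ℤ) (ℓ : ℕ) (hℓ : ℓ < d) (hpure : M.HasPureResolution d₀ d₁ d₂ ℓ) :
    (∀ i j, Module.Finite k (M.Tor i j)) ∧
    (∀ j, j ≠ d₀ → M.gradedBetti 0 j = 0) ∧
    (∀ j, j ≠ d₁ → M.gradedBetti 1 j = 0) ∧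
    (∀ i : ℕ, 2 ≤ i → ∀ j, j ≠ d₂ + ((i : ℤ) - 2) → M.gradedBetti i j = 0) ∧
    (∃ c : ℚ, (Nontrivial M.carrier → 0 < c) ∧
      (M.betti 0 : ℚ) = c * ((d : ℚ) * ((d₂ : ℚ) - (d₁ : ℚ)) - (ℓ : ℚ)) ∧
      (M.betti 1 : ℚ) = c * ((d : ℚ) * ((d₂ : ℚ) - (d₀ : ℚ)) - (ℓ : ℚ)) ∧
      (M.betti 2 : ℚ) = c * ((d : ℚ) * ((d₁ : ℚ) - (d₀ : ℚ)) * ((ℓ : ℚ) + 1))) ∧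
    (∀ i : ℕ, 3 ≤ i →
      (M.betti i : ℚ) =
        ((d : ℚ) - 1) ^ (i - 3) * (M.betti 2 : ℚ) * ((d : ℚ) * (ℓ : ℚ) / ((ℓ : ℚ) + 1))) := by
  obtain ⟨a, b, r, ⟨Q⟩⟩ := hpure.exists_pureResolution
  refine ⟨Q.finite_tor, fun j hj => Q.gradedBetti_eq_zero 0 hj,
    fun j hj => Q.gradedBetti_eq_zero 1 hj, fun i hi j hj => ?_, ?_, fun i hi => ?_⟩
  · obtain ⟨i, rfl⟩ := Nat.exists_eq_add_of_le' hi
    refine Q.gradedBetti_eq_zero (i + 2) ?_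
    change j ≠ RatNormal.strandDegree d₂ i
    rw [RatNormal.strandDegree_eq]
    push_cast at hj
    rwa [add_sub_cancel_right] at hj
  · obtain ⟨c, hc, h0, h1, h2⟩ := Q.exists_rank_eq hM
    refine ⟨c, hc, ?_, ?_, ?_⟩
    · rw [Q.betti_zero, h0]
    · rw [Q.betti_one, h1]
    · rw [Q.betti_two, Nat.cast_mul, h2]
      push_cast
      ring
  · obtain ⟨i, rfl⟩ := Nat.exists_eq_add_of_le' hi
    have hℓ' : (ℓ : ℚ) + 1 ≠ 0 := by positivity
    -- The claim becomes rℓ(d-1)^i d = (d-1)^i · r(ℓ+1) · dℓ/(ℓ+1). The cast of the truncated d - 1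
    -- uses d ≥ 1.
    rw [Q.betti_add_three, Q.betti_two, Nat.add_sub_cancel]
    push_cast [Nat.one_le_iff_ne_zero.2 (NeZero.ne d)]
    field_simp
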